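/- Let $\lambda\in(0,1)$, $a\in\left[-\frac{2\lambda}{1+\lambda},\frac{2\lambda}{1-\lambda}\right]$ and $\alpha,\beta\in\mathbb{R}$ be fixed. All complex powers and arguments below are principal (so $\mathrm{Arg}\in(-\pi,\pi]$). For $n\in\mathbb{N}$ put $$I_n=\frac1\pi\,\mathrm{Re}\left\{\int_0^\pi z^{\alpha+1}\frac{(1-\lambda z)^\beta}{z-\lambda}\left(z^{a+1}\frac{1-\lambda z}{z-\lambda}\right)^n\Bigg|_{z=e^{i\varphi}}\,d\varphi\right\},$$ and $$h(\varphi)=\mathrm{Arg}\left(\frac{z^{a+1}(1-\lambda z)}{z-\lambda}\right)\Bigg|_{z=e^{i\varphi}}.$$ Then, as $n\to\infty$ (implied constants may depend on $\lambda,a,\alpha,\beta$): 1. If $a\in\left(-\frac{2\lambda}{1+\lambda},\frac{2\lambda}{1-\lambda}\right)$, then there is exactly one $\varphi_+\in[0,\pi]$ with $$e^{i\varphi_+}=c+i\sqrt{1-c^2},\qquad c=\frac{a+a\lambda^2+2\lambda^2}{2\lambda(a+1)},$$ and, with $z_+=e^{i\varphi_+}$, exactly one $\psi\in(-\pi,\pi]$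 with $\sqrt{\frac{1-\lambda^2}{a+1}}\,e^{i\psi}=1-\lambda z_+$, and $$I_n=\sqrt{\frac{2}{n\pi}}\,\frac{(1-\lambda^2)^{\beta/2}}{(a+1)^{\beta/2}}\,\frac{\cos\left((n+1)h(\varphi_+)+(\alpha-a)\varphi_++(\beta-1)\psi+\frac{\pi}{4}\right)}{\left[(1-\lambda^2)((a+2)\lambda+a)((a+2)\lambda-a)\right]^{1/4}}+\frac{\sin((an+\alpha)\pi)}{n\pi}\,\frac{(1+\lambda)^\beta}{a(1+\lambda)+2\lambda}+O(n^{-3/2}).$$ 2. If $a=\frac{2\lambda}{1-\lambda}$, then $$I_n=\frac{(1-\lambda)^\beta}{3^{2/3}\,\Gamma(2/3)\,n^{1/3}\lambda^{1/3}(1+\lambda)^{1/3}}\left(1+O(n^{-1/3})\right).$$ 3. If $a=-\frac{2\lambda}{1+\lambda}$, put $$M_n=\frac1\pi\cos\left(\left(an+\alpha+\tfrac16\right)\pi\right)\frac{\Gamma(1/3)(1+\lambda)^\beta}{3^{2/3}}\left(\frac{1}{n\lambda(1-\lambda)}\right)^{1/3}.$$ Then $I_n=M_n+O(n^{-2/3})$.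 Moreover, for every $\delta>0$, $I_n=M_n\left(1+O(n^{-1/3})\right)$ as $n\to\infty$ along those $n$ with $\left|\cos\left(\left(an+\alpha+\frac16\right)\pi\right)\right|\ge\delta$ (the implied constant may also depend on $\delta$). -/

import Mathlib

open Filter Asymptotics

noncomputable section

namespace UnitCircleIntegral

/-- The point `z = e^{iφ}` of the unit circle. -/
def circlePt (φ : ℝ) : ℂ := Complex.exp ((φ : ℂ) * Complex.I)

/-- The unimodular function `z ^ (a + 1) * (1 - λ z) / (z - λ)`; the power is the principal one. -/
def base (lam a : ℝ) (z : ℂ) : ℂ :=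
  z ^ ((a : ℂ) + 1) * ((1 - (lam : ℂ) * z) / (z - (lam : ℂ)))

/-- The amplitude `z ^ (α + 1) * (1 - λ z) ^ β / (z - λ)`; the powers are the principal ones. -/
def amplitude (lam α β : ℝ) (z : ℂ) : ℂ :=
  z ^ ((α : ℂ) + 1) * ((1 - (lam : ℂ) * z) ^ (β : ℂ) / (z - (lam : ℂ)))

/-- The phase `h(φ) = Arg (z ^ (a + 1) * (1 - λ z) / (z - λ))` at `z = e^{iφ}`
(principal argument). -/
def phase (lam a φ : ℝ) : ℝ := Complex.arg (base lam a (circlePt φ))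

/-- The quantity `(1/π) Re ∫₀^π z^(α+1) (1-λz)^β/(z-λ) (z^(a+1) (1-λz)/(z-λ))^n dφ`,
where `z = e^{iφ}`. -/
def fourierIntegral (lam a α β : ℝ) (n : ℕ) : ℝ :=
  1 / Real.pi *
    (∫ φ in (0 : ℝ)..Real.pi,
      amplitude lam α β (circlePt φ) * (base lam a (circlePt φ)) ^ n).re

/-- The number `(a + a λ² + 2 λ²) / (2 λ (a + 1))`. -/
def cosPhiPlus (lam a : ℝ) : ℝ :=
  (a + a * lam ^ 2 + 2 * lam ^ 2) / (2 * lam * (a + 1))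

/-- The defining relation of `φ₊ ∈ [0, π]`. -/
def IsPhiPlus (lam a φ : ℝ) : Prop :=
  φ ∈ Set.Icc 0 Real.pi ∧
    circlePt φ = (cosPhiPlus lam a : ℂ) + Complex.I * (√(1 - cosPhiPlus lam a ^ 2) : ℝ)

/-- The defining relation of `ψ`: it is the value in `(-π, π]` of the argument of `1 - λ z₊`, whose
modulus is `√((1 - λ²) / (a + 1))`; here `z₊ = e^{iφ₊}`. -/
def IsPsi (lam a φ ψ : ℝ) : Prop :=
  ψ ∈ Set.Ioc (-Real.pi) Real.pi ∧
    (√((1 - lam ^ 2) / (a + 1)) : ℝ) * circlePt ψ = 1 - (lam : ℂ) * circlePt φ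

/-- The `n^{-1/2}` term coming from the stationary point. -/
def stationaryTerm (lam a α β φ ψ : ℝ) (n : ℕ) : ℝ :=
  √(2 / (n * Real.pi)) * ((1 - lam ^ 2) ^ (β / 2) / (a + 1) ^ (β / 2)) *
    (Real.cos ((n + 1) * phase lam a φ + (α - a) * φ + (β - 1) * ψ + Real.pi / 4) /
      ((1 - lam ^ 2) * ((a + 2) * lam + a) * ((a + 2) * lam - a)) ^ (1 / 4 : ℝ))

/-- The `n^{-1}` term coming from the endpoint `φ = π`. -/
def endpointTerm (lam a α β : ℝ) (n : ℕ) : ℝ :=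
  Real.sin ((a * n + α) * Real.pi) / (n * Real.pi) *
    ((1 + lam) ^ β / (a * (1 + lam) + 2 * lam))

/-- The leading term for `a = 2λ/(1-λ)`. -/
def upperTerm (lam β : ℝ) (n : ℕ) : ℝ :=
  (1 - lam) ^ β /
    (3 ^ (2 / 3 : ℝ) * Real.Gamma (2 / 3) * (n : ℝ) ^ (1 / 3 : ℝ) * lam ^ (1 / 3 : ℝ) *
      (1 + lam) ^ (1 / 3 : ℝ))

/-- The leading term for `a = -2λ/(1+λ)`. -/
def lowerTerm (lam a α β : ℝ) (n : ℕ) : ℝ :=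
  1 / Real.pi * Real.cos ((a * n + α + 1 / 6) * Real.pi) *
    (Real.Gamma (1 / 3) * (1 + lam) ^ β / 3 ^ (2 / 3 : ℝ)) *
      (1 / (n * lam * (1 - lam))) ^ (1 / 3 : ℝ)

end UnitCircleIntegral

end

namespace UnitCircleIntegral

open MeasureTheory Set Topology ComplexConjugate

/-! On the unit circle `z - λ = z * conj (1 - λ z)`. The base of the `n`-th power is therefore `exp
(i H(φ))` with `H(φ) = a φ + 2 arg (1 - λ e^{iφ})`. Since `1 - λ z` stays in the right half plane,
`H` and the amplitude are real-analytic, and `I_n` is an oscillatory integral with large parameter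
`n`. Moreover `H' = 2λ(a+1)(c - cos φ) / |1 - λ z|²`. For `a` in the open interval, `|c| < 1` and
`H` has a single nondegenerate minimum `φ₊` inside `(0, π)`. At the upper value of `a`, `c = 1` and
`H'` vanishes to second order at `0`. At the lower value, `c = -1` and the same happens at `π`. This
accounts for the orders `n^{-1/2}` and `n^{-1/3}`.

The analytic core is stationary phase with explicit error (`isBigO_stationary_phase`,
`isBigO_stationary_phase_endpoint`). `exists_coordinate` writes `H = H(c) + u^(k+1)` for an analytic
coordinate `u`, where `c` now denotes the critical point. The amplitude divided by `u'` is then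
expanded in powers of `u`. Its value at `c` multiplies a model integral of `exp (i T v^(k+1))`. A
part carrying the factor `u^k u'` gains `1/T` by integration by parts. In the cubic case the
intermediate term, linear in `u`, is `O(T^{-2/3})`.

The model integral (`exists_norm_fresnel_sub_le`) is a boundary value. For `re r > 0`, `∫ exp (-r
v^m)` over the half line follows from the Gamma function by analytic continuation, and its tail is
expanded with an error uniform in `r`. That uniformity permits letting `r` tend to the imaginary
axis.

What remains is evaluation at the critical point and the endpoints. At `φ = 0` the integrand is
real, so its endpoint term is purely imaginary and drops out of the real part. At `φ = π` the
endpoint term gives the sine term. -/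

/-! ### Generalized Fresnel integrals -/

lemma norm_cexp_neg_mul_pow (r : ℂ) (m : ℕ) (v : ℝ) :
    ‖Complex.exp (-r * (v : ℂ) ^ m)‖ = Real.exp (-r.re * v ^ m) := by
  rw [Complex.norm_exp]
  congr 1
  rw [← Complex.ofReal_pow, Complex.re_mul_ofReal, Complex.neg_re]

lemma integrableOn_pow_mul_exp_neg_mul_pow (j : ℕ) {m : ℕ} (hm : 1 ≤ m) {b : ℝ} (hb : 0 < b) :
    IntegrableOn (fun v : ℝ => v ^ j * Real.exp (-b * v ^ m)) (Ioi 0) := by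
  have h := integrableOn_rpow_mul_exp_neg_mul_rpow (p := (m : ℝ)) (s := (j : ℝ)) (b := b)
    (by have : (0 : ℝ) ≤ j := by positivity
        linarith) (by exact_mod_cast hm) hb
  simpa only [Real.rpow_natCast] using h

lemma integrableOn_cexp_neg_mul_pow {m : ℕ} (hm : 1 ≤ m) {r : ℂ} (hr : 0 < r.re) :
    IntegrableOn (fun v : ℝ => Complex.exp (-r * (v : ℂ) ^ m)) (Ioi 0) := by
  have h := integrableOn_pow_mul_exp_neg_mul_pow 0 hm hr
  refine Integrable.mono' h (Continuous.aestronglyMeasurable (by fun_prop)) ?_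
  refine Eventually.of_forall fun v => ?_
  rw [norm_cexp_neg_mul_pow]
  simp

/-- The integral `∫₀^∞ exp (-r v ^ m) dv` is holomorphic in the half plane `0 < re r`. -/
lemma differentiableOn_integral_cexp_neg_mul_pow {m : ℕ} (hm : 1 ≤ m) :
    DifferentiableOn ℂ (fun r : ℂ => ∫ v : ℝ in Ioi 0, Complex.exp (-r * (v : ℂ) ^ m))
      {r | 0 < r.re} := by
  intro r₀ hr₀
  have hr₀' : 0 < r₀.re := hr₀
  -- A radius of half the distance to the imaginary axis leaves decay rate at least `r₀.re / 2`,
  -- hence one dominating function for the whole ball.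
  have hball : ∀ r ∈ Metric.ball r₀ (r₀.re / 2), r₀.re / 2 < r.re := by
    intro r hr
    have h1 : |(r - r₀).re| ≤ ‖r - r₀‖ := Complex.abs_re_le_norm _
    rw [Metric.mem_ball, dist_eq_norm] at hr
    have h2 := (abs_lt.mp (h1.trans_lt hr)).1
    simp only [Complex.sub_re] at h2
    linarith
  have key := hasDerivAt_integral_of_dominated_loc_of_deriv_le
    (μ := volume.restrict (Ioi (0 : ℝ)))
    (F := fun (r : ℂ) (v : ℝ) => Complex.exp (-r * (v : ℂ) ^ m))
    (F' := fun (r : ℂ) (v : ℝ) => Complex.exp (-r * (v : ℂ) ^ m) * (-(v : ℂ) ^ m))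
    (x₀ := r₀) (s := Metric.ball r₀ (r₀.re / 2))
    (bound := fun v : ℝ => v ^ m * Real.exp (-(r₀.re / 2) * v ^ m))
    (Metric.ball_mem_nhds _ (by linarith))
    (Eventually.of_forall fun r => Continuous.aestronglyMeasurable (by fun_prop))
    (integrableOn_cexp_neg_mul_pow hm hr₀')
    (Continuous.aestronglyMeasurable (by fun_prop))
    ?_ (integrableOn_pow_mul_exp_neg_mul_pow m hm (by linarith)) ?_
  · exact key.2.differentiableAt.differentiableWithinAt
  · refine (ae_restrict_iff' measurableSet_Ioi).mpr (Eventually.of_forall fun v hv r hr => ?_)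
    have hv0 : (0 : ℝ) < v := hv
    rw [norm_mul, norm_cexp_neg_mul_pow, norm_neg, norm_pow, Complex.norm_real, Real.norm_eq_abs,
      abs_of_pos hv0, mul_comm]
    have h3 := hball r hr
    have h4 : 0 < v ^ m := by positivity
    gcongr
  · refine Eventually.of_forall fun v r _ => ?_
    have h : HasDerivAt (fun r : ℂ => -r * (v : ℂ) ^ m) (-(v : ℂ) ^ m) r := by
      simpa using ((hasDerivAt_id r).neg.mul_const ((v : ℂ) ^ m))
    exact h.cexp

/-- The integral `∫₀^∞ exp (-r v ^ m) dv` for complex `r` in the right half plane. -/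
lemma integral_cexp_neg_mul_pow {m : ℕ} (hm : 1 ≤ m) {r : ℂ} (hr : 0 < r.re) :
    ∫ v : ℝ in Ioi 0, Complex.exp (-r * (v : ℂ) ^ m) =
      r ^ (-(1 / m : ℂ)) * (Real.Gamma (1 / m + 1) : ℂ) := by
  have hopen : IsOpen {r : ℂ | 0 < r.re} := isOpen_lt continuous_const Complex.continuous_re
  have hconv : Convex ℝ {r : ℂ | 0 < r.re} := convex_halfSpace_re_gt 0
  have h1 := (differentiableOn_integral_cexp_neg_mul_pow hm).analyticOnNhd hopen
  have h2 : AnalyticOnNhd ℂ (fun r : ℂ => r ^ (-(1 / m : ℂ)) * (Real.Gamma (1 / m + 1) : ℂ))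
      {r : ℂ | 0 < r.re} := by
    refine DifferentiableOn.analyticOnNhd ?_ hopen
    intro z hz
    refine DifferentiableAt.differentiableWithinAt ?_
    exact (differentiableAt_id.cpow_const (Or.inl hz)).mul_const _
  -- Identity theorem: both sides are holomorphic in the half plane and agree on the positive reals,
  -- which accumulate at `1`.
  refine h1.eqOn_of_preconnected_of_frequently_eq h2 hconv.isPreconnected
    (z₀ := (1 : ℂ)) (by simp) ?_ hr
  have hreal : ∀ b : ℝ, 0 < b →
      ∫ v : ℝ in Ioi 0, Complex.exp (-(b : ℂ) * (v : ℂ) ^ m) =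
        (b : ℂ) ^ (-(1 / m : ℂ)) * (Real.Gamma (1 / m + 1) : ℂ) := by
    intro b hb
    have h := integral_exp_neg_mul_rpow (p := (m : ℝ)) (b := b) (by exact_mod_cast hm) hb
    simp only [Real.rpow_natCast] at h
    have h' := congrArg (fun x : ℝ => (x : ℂ)) h
    rw [← integral_complex_ofReal] at h'
    push_cast at h'
    rw [h', Complex.ofReal_cpow hb.le]
    push_cast
    congr 2
    ring
  have hseq : Tendsto (fun x : ℝ => (x : ℂ)) (𝓝[≠] 1) (𝓝[≠] 1) := by
    refine tendsto_nhdsWithin_of_tendsto_nhds_of_eventually_within _ ?_ ?_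
    · exact (Complex.continuous_ofReal.tendsto' 1 1 (by simp)).mono_left nhdsWithin_le_nhds
    · filter_upwards [self_mem_nhdsWithin] with x hx
      simpa using hx
  refine hseq.frequently (Eventually.frequently ?_)
  have : ∀ᶠ x : ℝ in 𝓝[≠] 1, 0 < x := nhdsWithin_le_nhds (lt_mem_nhds one_pos)
  filter_upwards [this] with b hb using hreal b hb

/-- Two integrations by parts of the tail, recorded as an antiderivative. The leftover is `r⁻²`
times a function bounded by `v^(-2k-2)`, integrable at infinity without help from the exponential,
so the estimate survives as `re r → 0`. -/
lemma hasDerivAt_cexp_tail (k : ℕ) {r : ℂ} (hr : r ≠ 0) {v : ℝ} (hv : 0 < v) :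
    HasDerivAt (fun v : ℝ => Complex.exp (-r * (v : ℂ) ^ (k + 1)) *
        (-(1 / ((k + 1) * r * (v : ℂ) ^ k)) + k / (k + 1) ^ 2 / (r ^ 2 * (v : ℂ) ^ (2 * k + 1))))
      (Complex.exp (-r * (v : ℂ) ^ (k + 1)) -
        k * (2 * k + 1) / (k + 1) ^ 2 / r ^ 2 *
          (Complex.exp (-r * (v : ℂ) ^ (k + 1)) / (v : ℂ) ^ (2 * k + 2))) v := by
  have hv0 : (v : ℂ) ≠ 0 := by exact_mod_cast hv.ne'
  have hk : (k : ℂ) + 1 ≠ 0 := by exact_mod_cast Nat.succ_ne_zero k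
  -- Writing `v ^ j / v` instead of `v ^ (j - 1)` avoids truncated subtraction at `j = 0`.
  have hp : ∀ j : ℕ, HasDerivAt (fun z : ℂ => z ^ j) (j * (v : ℂ) ^ j / v) (v : ℂ) := by
    intro j
    refine (hasDerivAt_pow j _).congr_deriv ?_
    rcases j with _ | j
    · simp
    · rw [Nat.add_sub_cancel, pow_succ]
      field_simp
  have hE : HasDerivAt (fun z : ℂ => Complex.exp (-r * z ^ (k + 1)))
      (Complex.exp (-r * (v : ℂ) ^ (k + 1)) * (-r * ((k + 1 : ℕ) * (v : ℂ) ^ (k + 1) / v)))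
      (v : ℂ) :=
    ((hp (k + 1)).const_mul (-r)).cexp
  have hA : HasDerivAt (fun z : ℂ => -(1 / ((k + 1) * r * z ^ k)))
      (-(-((k + 1) * r * (k * (v : ℂ) ^ k / v)) / ((k + 1) * r * (v : ℂ) ^ k) ^ 2)) (v : ℂ) := by
    simp only [one_div]
    exact (((hp k).const_mul ((k + 1) * r)).fun_inv
      (mul_ne_zero (mul_ne_zero hk hr) (pow_ne_zero _ hv0))).fun_neg
  have hB : HasDerivAt (fun z : ℂ => k / (k + 1) ^ 2 / (r ^ 2 * z ^ (2 * k + 1)))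
      (k / (k + 1) ^ 2 * (-(r ^ 2 * ((2 * k + 1 : ℕ) * (v : ℂ) ^ (2 * k + 1) / v)) /
        (r ^ 2 * (v : ℂ) ^ (2 * k + 1)) ^ 2)) (v : ℂ) := by
    simp only [div_eq_mul_inv _ (r ^ 2 * _ ^ (2 * k + 1))]
    exact (((hp (2 * k + 1)).const_mul (r ^ 2)).fun_inv
      (mul_ne_zero (pow_ne_zero _ hr) (pow_ne_zero _ hv0))).const_mul _
  refine (hE.fun_mul (hA.fun_add hB)).comp_ofReal.congr_deriv ?_
  push_cast
  field_simp
  ring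

lemma tendsto_cexp_tail (k : ℕ) {r : ℂ} (hr : 0 < r.re) :
    Tendsto (fun v : ℝ => Complex.exp (-r * (v : ℂ) ^ (k + 1)) *
        (-(1 / ((k + 1) * r * (v : ℂ) ^ k)) + k / (k + 1) ^ 2 / (r ^ 2 * (v : ℂ) ^ (2 * k + 1))))
      atTop (𝓝 0) := by
  have h1 : Tendsto (fun v : ℝ => Real.exp (-r.re * v ^ (k + 1))) atTop (𝓝 0) := by
    refine Real.tendsto_exp_atBot.comp ?_
    exact (tendsto_pow_atTop (Nat.succ_ne_zero k)).const_mul_atTop_of_neg (by linarith)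
  have h2 : Tendsto (fun v : ℝ => Real.exp (-r.re * v ^ (k + 1)) *
      (‖1 / ((k + 1) * r)‖ + ‖(k : ℂ) / (k + 1) ^ 2 / r ^ 2‖)) atTop (𝓝 0) := by
    simpa only [zero_mul] using h1.mul_const (‖1 / ((k + 1) * r)‖ + ‖(k : ℂ) / (k + 1) ^ 2 / r ^ 2‖)
  refine squeeze_zero_norm' ?_ h2
  filter_upwards [eventually_ge_atTop 1] with v hv
  rw [norm_mul, norm_cexp_neg_mul_pow]
  have hpow : ∀ j : ℕ, ∀ w : ℂ, ‖w / (v : ℂ) ^ j‖ ≤ ‖w‖ := by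
    intro j w
    rw [norm_div, norm_pow, Complex.norm_real, Real.norm_of_nonneg (by linarith)]
    exact div_le_self (norm_nonneg _) (one_le_pow₀ hv)
  gcongr
  refine (norm_add_le _ _).trans (add_le_add ?_ ?_)
  · rw [norm_neg, ← div_div]
    exact hpow _ _
  · rw [← div_div]
    exact hpow _ _

/-- Two terms of the asymptotics of `∫₀^B exp (-r v ^ (k + 1)) dv`, uniformly in the right half
plane. -/
lemma exists_norm_integral_cexp_sub_le (k : ℕ) {B : ℝ} (hB : 0 < B) :
    ∃ C : ℝ, ∀ r : ℂ, 0 < r.re →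
      ‖(∫ v in (0 : ℝ)..B, Complex.exp (-r * (v : ℂ) ^ (k + 1))) -
        (r ^ (-(1 / (k + 1 : ℕ) : ℂ)) * (Real.Gamma (1 / (k + 1 : ℕ) + 1) : ℂ) -
          Complex.exp (-r * (B : ℂ) ^ (k + 1)) / ((k + 1) * r * (B : ℂ) ^ k))‖ ≤ C / ‖r‖ ^ 2 := by
  set c : ℂ := k * (2 * k + 1) / (k + 1) ^ 2 with hc
  have hpowint : IntegrableOn (fun v : ℝ => (v ^ (2 * k + 2))⁻¹) (Ioi B) := by
    have h := integrableOn_Ioi_rpow_of_lt (a := -((2 * k + 2 : ℕ) : ℝ)) (c := B)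
      (by push_cast; have : (0 : ℝ) ≤ k := by positivity
          linarith) hB
    refine h.congr_fun (fun v hv => ?_) measurableSet_Ioi
    have hv0 : 0 < v := hB.trans hv
    simp only [Real.rpow_neg hv0.le, Real.rpow_natCast]
  -- The constant is the second-order boundary term at `B` plus the leftover tail integral, with the
  -- exponential bounded by `1`. It does not depend on `r`.
  refine ⟨‖(k : ℂ) / (k + 1) ^ 2 / (B : ℂ) ^ (2 * k + 1)‖ +
    ‖c‖ * ∫ v in Ioi B, (v ^ (2 * k + 2))⁻¹, fun r hr => ?_⟩
  have hr0 : r ≠ 0 := by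
    rintro rfl
    simp at hr
  set E : ℝ → ℂ := fun v => Complex.exp (-r * (v : ℂ) ^ (k + 1)) with hE
  have hEnorm : ∀ v : ℝ, 0 ≤ v → ‖E v‖ ≤ 1 := by
    intro v hv
    simp only [hE, norm_cexp_neg_mul_pow]
    rw [Real.exp_le_one_iff]
    have : 0 ≤ r.re * v ^ (k + 1) := by positivity
    linarith
  have hint0 : IntegrableOn E (Ioi 0) := integrableOn_cexp_neg_mul_pow (Nat.succ_pos k) hr
  have hintB : IntegrableOn E (Ioi B) := hint0.mono_set (Ioi_subset_Ioi hB.le)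
  have hEcont : Continuous E := by simp only [hE]; fun_prop
  have hbound : ∀ v ∈ Ioi B, ‖E v / (v : ℂ) ^ (2 * k + 2)‖ ≤ (v ^ (2 * k + 2))⁻¹ := by
    intro v hv
    have hv0 : 0 < v := hB.trans hv
    rw [norm_div, norm_pow, Complex.norm_real, Real.norm_of_nonneg hv0.le, ← one_div]
    gcongr
    exact hEnorm v hv0.le
  have hint2 : IntegrableOn (fun v : ℝ => E v / (v : ℂ) ^ (2 * k + 2)) (Ioi B) := by
    refine Integrable.mono' hpowint ?_ ((ae_restrict_iff' measurableSet_Ioi).mpr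
      (Eventually.of_forall hbound))
    refine ContinuousOn.aestronglyMeasurable ?_ measurableSet_Ioi
    refine hEcont.continuousOn.div (by fun_prop) fun v hv => ?_
    exact pow_ne_zero _ (by exact_mod_cast (hB.trans hv).ne')
  have htail := integral_Ioi_of_hasDerivAt_of_tendsto'
    (fun v hv => hasDerivAt_cexp_tail k hr0 (hB.trans_le hv))
    (hintB.sub (hint2.const_mul (c / r ^ 2))) (tendsto_cexp_tail k hr)
  rw [integral_sub hintB (hint2.const_mul (c / r ^ 2)), integral_const_mul] at htail
  have hsplit : (∫ v in (0 : ℝ)..B, E v) + ∫ v in Ioi B, E v = ∫ v in Ioi 0, E v := by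
    rw [intervalIntegral.integral_interval_add_Ioi hint0 hintB]
  rw [integral_cexp_neg_mul_pow (Nat.succ_pos k) hr] at hsplit
  have heq : (∫ v in (0 : ℝ)..B, E v) -
        (r ^ (-(1 / (k + 1 : ℕ) : ℂ)) * (Real.Gamma (1 / (k + 1 : ℕ) + 1) : ℂ) -
          E B / ((k + 1) * r * (B : ℂ) ^ k)) =
      (E B * ((k : ℂ) / (k + 1) ^ 2 / (B : ℂ) ^ (2 * k + 1)) -
        c * ∫ v in Ioi B, E v / (v : ℂ) ^ (2 * k + 2)) / r ^ 2 := by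
    rw [← hsplit]
    have h1 : ∫ v in Ioi B, E v = c / r ^ 2 * (∫ v in Ioi B, E v / (v : ℂ) ^ (2 * k + 2)) -
        E B * (-(1 / ((k + 1) * r * (B : ℂ) ^ k)) +
          k / (k + 1) ^ 2 / (r ^ 2 * (B : ℂ) ^ (2 * k + 1))) := by
      linear_combination htail
    rw [h1]
    rw [← div_div _ (r ^ 2)]
    ring
  rw [heq, norm_div, norm_pow]
  gcongr
  refine (norm_sub_le _ _).trans (add_le_add ?_ ?_)
  · rw [norm_mul]
    exact mul_le_of_le_one_left (norm_nonneg _) (hEnorm B hB.le)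
  · rw [norm_mul]
    gcongr
    exact norm_integral_le_of_norm_le hpowint ((ae_restrict_iff' measurableSet_Ioi).mpr
      (Eventually.of_forall hbound))

/-- Source of the phase shifts `π/4` and `π/6` in the final formulas: `log (-i) = -iπ/2`, multiplied
by `-1/2` or `-1/3`. -/
lemma neg_I_mul_cpow {T : ℝ} (hT : 0 < T) (s : ℝ) :
    (-(Complex.I * T)) ^ (-(s : ℂ)) =
      ((T ^ (-s) : ℝ) : ℂ) * Complex.exp (Complex.I * (s * (Real.pi / 2))) := by
  have harg : -(Complex.I * T) = (T : ℂ) * -Complex.I := by ring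
  have hne : (T : ℂ) * -Complex.I ≠ 0 := by simp [hT.ne']
  rw [harg, Complex.cpow_def_of_ne_zero hne, Complex.log_ofReal_mul hT (by simp),
    Complex.log_neg_I, add_mul, Complex.exp_add, Real.rpow_def_of_pos hT]
  push_cast
  congr 2
  ring

/-- Two terms of the asymptotics of the generalized Fresnel integral `∫₀^B exp (i T v ^ (k + 1))`. -/
lemma exists_norm_fresnel_sub_le (k : ℕ) {B : ℝ} (hB : 0 < B) :
    ∃ C : ℝ, ∀ T : ℝ, 0 < T →
      ‖(∫ v in (0 : ℝ)..B, Complex.exp (Complex.I * T * (v : ℂ) ^ (k + 1))) -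
        (((T ^ (-(1 / (k + 1 : ℕ)) : ℝ) : ℝ) : ℂ) *
            Complex.exp (Complex.I * ((1 / (k + 1 : ℕ) : ℝ) * (Real.pi / 2))) *
            (Real.Gamma (1 / (k + 1 : ℕ) + 1) : ℂ) +
          Complex.exp (Complex.I * T * (B : ℂ) ^ (k + 1)) / (Complex.I * T * (k + 1) * (B : ℂ) ^ k))‖
        ≤ C / T ^ 2 := by
  obtain ⟨C, hC⟩ := exists_norm_integral_cexp_sub_le k hB
  refine ⟨C, fun T hT => ?_⟩
  have hB0 : (B : ℂ) ≠ 0 := by exact_mod_cast hB.ne'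
  have hk : (k : ℂ) + 1 ≠ 0 := by exact_mod_cast Nat.succ_ne_zero k
  have hT0 : (T : ℂ) ≠ 0 := by exact_mod_cast hT.ne'
  set r₀ : ℂ := -(Complex.I * T) with hr₀
  have hr₀0 : r₀ ≠ 0 := by simp [hr₀, hT.ne']
  have hslit : r₀ ∈ Complex.slitPlane := by
    refine Or.inr ?_
    simp [hr₀, hT.ne']
  -- The imaginary axis is approached from the right, through `ε - i T`. Over the finite interval
  -- `[0, B]` everything is continuous up to the limit, so the uniform bound passes to it.
  have hseq : Tendsto (fun ε : ℝ => (ε : ℂ) + r₀) (𝓝[>] 0) (𝓝 r₀) := by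
    have : Continuous fun ε : ℝ => (ε : ℂ) + r₀ := by fun_prop
    exact (this.tendsto' 0 r₀ (by simp)).mono_left nhdsWithin_le_nhds
  have hcont : ContinuousAt (fun r : ℂ =>
      ‖(∫ v in (0 : ℝ)..B, Complex.exp (-r * (v : ℂ) ^ (k + 1))) -
        (r ^ (-(1 / (k + 1 : ℕ) : ℂ)) * (Real.Gamma (1 / (k + 1 : ℕ) + 1) : ℂ) -
          Complex.exp (-r * (B : ℂ) ^ (k + 1)) / ((k + 1) * r * (B : ℂ) ^ k))‖) r₀ := by
    refine ContinuousAt.norm (ContinuousAt.sub ?_ (ContinuousAt.sub ?_ ?_))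
    · exact (intervalIntegral.continuous_parametric_intervalIntegral_of_continuous'
        (f := fun (r : ℂ) (v : ℝ) => Complex.exp (-r * (v : ℂ) ^ (k + 1)))
        (by fun_prop) 0 B).continuousAt
    · exact (ContinuousAt.cpow continuousAt_id continuousAt_const hslit).mul continuousAt_const
    · refine ContinuousAt.div (by fun_prop) (by fun_prop) ?_
      exact mul_ne_zero (mul_ne_zero hk hr₀0) (pow_ne_zero _ hB0)
  have hcont2 : ContinuousAt (fun r : ℂ => C / ‖r‖ ^ 2) r₀ :=
    ContinuousAt.div (by fun_prop) (by fun_prop) (by simpa using hr₀0)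
  have hle := le_of_tendsto_of_tendsto (hcont.tendsto.comp hseq) (hcont2.tendsto.comp hseq) (by
    filter_upwards [self_mem_nhdsWithin] with ε hε
    refine hC _ ?_
    simpa [hr₀] using hε)
  have hnorm : ‖r₀‖ = T := by simp [hr₀, abs_of_pos hT]
  rw [hnorm] at hle
  refine le_trans (le_of_eq ?_) hle
  congr 1
  have hpow := neg_I_mul_cpow hT (1 / (k + 1 : ℕ))
  rw [← hpow]
  simp only [hr₀, neg_neg]
  push_cast
  rw [show ((k : ℂ) + 1) * -(Complex.I * T) * (B : ℂ) ^ k = -(Complex.I * T * (k + 1) * (B : ℂ) ^ k) by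
    ring, div_neg, sub_neg_eq_add]

/-! ### Analytic coordinates that normalize the phase -/

lemma analyticAt_dslope {E : Type*} [NormedAddCommGroup E] [NormedSpace ℝ E] [CompleteSpace E]
    {f : ℝ → E} {x : ℝ} (hf : AnalyticAt ℝ f x) (c : ℝ) : AnalyticAt ℝ (dslope f c) x := by
  rcases eq_or_ne x c with rfl | h
  · obtain ⟨p, hp⟩ := hf
    exact ⟨_, hp.has_fpower_series_dslope_fslope⟩
  · have hid : AnalyticAt ℝ (fun y : ℝ => y - c) x := by fun_prop
    have h1 : AnalyticAt ℝ (fun y => (y - c)⁻¹ • (f y - f c)) x :=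
      (hid.inv (sub_ne_zero.mpr h)).smul (hf.sub analyticAt_const)
    refine h1.congr ?_
    filter_upwards [dslope_eventuallyEq_slope_of_ne f h] with y hy
    rw [hy, slope, vsub_eq_sub]

/-- If `H' / (x - c) ^ k` tends to `ℓ`, the coefficient of `(x - c) ^ (k + 1)` in `H` is
`ℓ / (k + 1)`. -/
lemma coeff_of_tendsto_deriv {H K : ℝ → ℝ} {c ℓ : ℝ} {k : ℕ}
    (hK : AnalyticAt ℝ K c) (hHK : ∀ x, H x = H c + (x - c) ^ (k + 1) * K x)
    (hlim : Tendsto (fun x => deriv H x / (x - c) ^ k) (𝓝[≠] c) (𝓝 ℓ)) :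
    K c = ℓ / (k + 1) := by
  have hk : (k : ℝ) + 1 ≠ 0 := by positivity
  have hc1 : ContinuousAt (fun x => (k + 1) * K x + (x - c) * deriv K x) c := by
    have h1 := hK.continuousAt
    have h2 := hK.deriv.continuousAt
    fun_prop
  have hlim2 : Tendsto (fun x => deriv H x / (x - c) ^ k) (𝓝[≠] c) (𝓝 ((k + 1) * K c)) := by
    have h := hc1.tendsto.mono_left (nhdsWithin_le_nhds (s := {c}ᶜ))
    simp only [sub_self, zero_mul, add_zero] at h
    refine h.congr' ?_
    filter_upwards [nhdsWithin_le_nhds hK.eventually_analyticAt, self_mem_nhdsWithin] with x hx hxc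
    have hne : x - c ≠ 0 := sub_ne_zero.mpr hxc
    have hd : HasDerivAt H (0 + (((k + 1 : ℕ) * (x - c) ^ k * 1) * K x +
        (x - c) ^ (k + 1) * deriv K x)) x := by
      rw [show H = fun x => H c + (x - c) ^ (k + 1) * K x from funext hHK]
      refine (hasDerivAt_const _ _).add ?_
      have h1 := ((hasDerivAt_id x).sub_const c).pow (k + 1)
      exact h1.mul hx.differentiableAt.hasDerivAt
    rw [hd.deriv]
    push_cast
    field_simp
    ring
  have := tendsto_nhds_unique hlim hlim2
  field_simp
  linarith

/-- Induction on the order. If `H' / (x - c)^(k+1)` converges, then `H' / (x - c)^k` tends to `0`,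
so the cofactor found at order `k` vanishes at `c` and can be divided by `x - c` once more. -/
lemma exists_eq_pow_mul_of_tendsto_deriv {H : ℝ → ℝ} {c : ℝ} {s : Set ℝ}
    (hH : AnalyticOnNhd ℝ H s) (hc : c ∈ s) (k : ℕ) {ℓ : ℝ}
    (hlim : Tendsto (fun x => deriv H x / (x - c) ^ k) (𝓝[≠] c) (𝓝 ℓ)) :
    ∃ K : ℝ → ℝ, AnalyticOnNhd ℝ K s ∧ (∀ x, H x = H c + (x - c) ^ (k + 1) * K x) ∧
      K c = ℓ / (k + 1) := by
  induction k generalizing ℓ with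
  | zero =>
    have hK : AnalyticOnNhd ℝ (dslope H c) s := fun x hx => analyticAt_dslope (hH x hx) c
    have hHK : ∀ x, H x = H c + (x - c) ^ (0 + 1) * dslope H c x := by
      intro x
      have := sub_smul_dslope H c x
      rw [smul_eq_mul] at this
      rw [zero_add, pow_one, this]
      ring
    exact ⟨_, hK, hHK, coeff_of_tendsto_deriv (hK c hc) hHK hlim⟩
  | succ k ih =>
    have hlim0 : Tendsto (fun x => deriv H x / (x - c) ^ k) (𝓝[≠] c) (𝓝 0) := by
      have h1 : Tendsto (fun x : ℝ => x - c) (𝓝[≠] c) (𝓝 0) :=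
        (Continuous.tendsto' (by fun_prop) c 0 (by simp)).mono_left nhdsWithin_le_nhds
      have h2 := hlim.mul h1
      rw [mul_zero] at h2
      refine h2.congr' ?_
      filter_upwards [self_mem_nhdsWithin] with x hx
      have hne : x - c ≠ 0 := sub_ne_zero.mpr hx
      field_simp
      ring
    obtain ⟨K, hK, hHK, hKc⟩ := ih hlim0
    rw [zero_div] at hKc
    have hK' : AnalyticOnNhd ℝ (dslope K c) s := fun x hx => analyticAt_dslope (hK x hx) c
    have hHK₂ : ∀ x, H x = H c + (x - c) ^ (k + 1 + 1) * dslope K c x := by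
      intro x
      have := sub_smul_dslope K c x
      rw [smul_eq_mul, hKc, sub_zero] at this
      rw [hHK x, ← this]
      ring
    exact ⟨_, hK', hHK₂, coeff_of_tendsto_deriv (hK' c hc) hHK₂ hlim⟩

/-- `u` is an analytic coordinate on `[p, q]` vanishing exactly at `c`. -/
structure IsCoordinate (u : ℝ → ℝ) (p q c : ℝ) : Prop where
  mem : c ∈ Icc p q
  analytic : AnalyticOnNhd ℝ u (Icc p q)
  deriv_ne_zero : ∀ x ∈ Icc p q, deriv u x ≠ 0
  sign : ∀ x, ∃ w, u x = (x - c) * w ∧ (x ∈ Icc p q → 0 < w)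

/-- An analytic phase with a single critical point, of order `k`, is `H c + u ^ (k + 1)` for an
analytic coordinate `u`. -/
lemma exists_coordinate {H : ℝ → ℝ} {p q c ℓ : ℝ} (hc : c ∈ Icc p q)
    (hH : AnalyticOnNhd ℝ H (Icc p q)) (k : ℕ) (hℓ : 0 < ℓ)
    (hlim : Tendsto (fun x => deriv H x / (x - c) ^ k) (𝓝[≠] c) (𝓝 ℓ))
    (hsign : ∀ x ∈ Icc p q, x ≠ c → 0 < deriv H x / (x - c) ^ k) :
    ∃ u : ℝ → ℝ, IsCoordinate u p q c ∧
      (∀ x ∈ Icc p q, H =ᶠ[𝓝 x] fun y => H c + u y ^ (k + 1)) ∧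
      deriv u c = (ℓ / (k + 1)) ^ (1 / (k + 1) : ℝ) := by
  obtain ⟨K, hK, hHK, hKc⟩ := exists_eq_pow_mul_of_tendsto_deriv hH hc k hlim
  have hk : (0 : ℝ) < k + 1 := by positivity
  -- For `x ≠ c` the mean value theorem gives `K x = H'(ξ) / (x - c)^k` with `ξ` strictly between
  -- `c` and `x`. As `ξ - c` and `x - c` have the same sign, positivity transfers from `ξ`.
  have hKpos : ∀ x ∈ Icc p q, 0 < K x := by
    intro x hx
    have hdiff : ∀ y ∈ Icc p q, DifferentiableAt ℝ H y := fun y hy => (hH y hy).differentiableAt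
    rcases lt_trichotomy x c with hxc | rfl | hxc
    · have hsub : Icc x c ⊆ Icc p q := Icc_subset_Icc hx.1 hc.2
      obtain ⟨ξ, hξ, hs⟩ := exists_deriv_eq_slope H hxc
        (fun y hy => (hdiff y (hsub hy)).continuousAt.continuousWithinAt)
        (fun y hy => (hdiff y (hsub (Ioo_subset_Icc_self hy))).differentiableWithinAt)
      have h1 := hsign ξ (hsub (Ioo_subset_Icc_self hξ)) hξ.2.ne
      have h2 : K x = deriv H ξ / (x - c) ^ k := by
        have h3 : x - c ≠ 0 := sub_ne_zero.mpr hxc.ne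
        have h4 : c - x ≠ 0 := sub_ne_zero.mpr hxc.ne'
        rw [hs, hHK x]
        field_simp
        ring
      have h5 : deriv H ξ / (x - c) ^ k = deriv H ξ / (ξ - c) ^ k * ((ξ - c) / (x - c)) ^ k := by
        have h3 : x - c ≠ 0 := sub_ne_zero.mpr hxc.ne
        have h4 : ξ - c ≠ 0 := sub_ne_zero.mpr hξ.2.ne
        rw [div_pow]
        field_simp
      rw [h2, h5]
      exact mul_pos h1 (pow_pos (div_pos_of_neg_of_neg (by linarith [hξ.2]) (by linarith)) k)
    · rw [hKc]
      positivity
    · have hsub : Icc c x ⊆ Icc p q := Icc_subset_Icc hc.1 hx.2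
      obtain ⟨ξ, hξ, hs⟩ := exists_deriv_eq_slope H hxc
        (fun y hy => (hdiff y (hsub hy)).continuousAt.continuousWithinAt)
        (fun y hy => (hdiff y (hsub (Ioo_subset_Icc_self hy))).differentiableWithinAt)
      have h1 := hsign ξ (hsub (Ioo_subset_Icc_self hξ)) hξ.1.ne'
      have h2 : K x = deriv H ξ / (x - c) ^ k := by
        have h3 : x - c ≠ 0 := sub_ne_zero.mpr hxc.ne'
        rw [hs, hHK x]
        field_simp
        ring
      have h5 : deriv H ξ / (x - c) ^ k = deriv H ξ / (ξ - c) ^ k * ((ξ - c) / (x - c)) ^ k := by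
        have h3 : x - c ≠ 0 := sub_ne_zero.mpr hxc.ne'
        have h4 : ξ - c ≠ 0 := sub_ne_zero.mpr hξ.1.ne'
        rw [div_pow]
        field_simp
      rw [h2, h5]
      exact mul_pos h1 (pow_pos (div_pos (by linarith [hξ.1]) (by linarith)) k)
  -- The `(k+1)`-th root of `K`, taken as `exp (log K / (k+1))` so that it is analytic wherever `K >
  -- 0`.
  set w : ℝ → ℝ := fun x => Real.exp (Real.log (K x) * (1 / (k + 1))) with hw
  have hwan : AnalyticOnNhd ℝ w (Icc p q) := fun x hx =>
    (((hK x hx).log (hKpos x hx)).mul analyticAt_const).rexp'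
  have hwpow : ∀ x, 0 < K x → w x ^ (k + 1) = K x := by
    intro x hx
    simp only [hw]
    rw [← Real.exp_nat_mul]
    push_cast
    rw [show ((k : ℝ) + 1) * (Real.log (K x) * (1 / (k + 1))) = Real.log (K x) by field_simp,
      Real.exp_log hx]
  set u : ℝ → ℝ := fun x => (x - c) * w x with hu
  have hid : ∀ x, AnalyticAt ℝ (fun x : ℝ => x - c) x := fun x => by fun_prop
  have huan : AnalyticOnNhd ℝ u (Icc p q) := fun x hx => (hid x).mul (hwan x hx)
  have hHu : ∀ x ∈ Icc p q, H =ᶠ[𝓝 x] fun y => H c + u y ^ (k + 1) := by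
    intro x hx
    filter_upwards [(hK x hx).continuousAt.eventually (lt_mem_nhds (hKpos x hx))] with y hy
    rw [hHK y, hu]
    simp only [mul_pow, hwpow y hy]
  have huc : deriv u c = w c := by
    have h := ((hasDerivAt_id c).sub_const c).fun_mul (hwan c hc).differentiableAt.hasDerivAt
    have := h.deriv
    simpa [hu] using this
  refine ⟨u, ⟨hc, huan, fun x hx => ?_, fun x => ⟨w x, rfl, fun _ => Real.exp_pos _⟩⟩, hHu, ?_⟩
  · rcases eq_or_ne x c with rfl | hxc
    · rw [huc]
      exact (Real.exp_pos _).ne'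
    -- Away from `c`, `H' = (k+1) u^k u'` is nonzero, hence so is `u'`.
    · intro h0
      have h1 := hsign x hx hxc
      have h2 : deriv H x = 0 := by
        rw [(hHu x hx).deriv_eq]
        have h3 := (((huan x hx).differentiableAt.hasDerivAt.pow (k + 1)).const_add (H c)).deriv
        simp only [h0, mul_zero] at h3
        exact h3
      rw [h2, zero_div] at h1
      exact lt_irrefl _ h1
  · rw [huc, Real.rpow_def_of_pos (by positivity), ← hKc]

lemma IsCoordinate.apply_eq_zero {u : ℝ → ℝ} {p q c : ℝ} (hu : IsCoordinate u p q c) :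
    u c = 0 := by
  obtain ⟨w, hw, -⟩ := hu.sign c
  simpa using hw

lemma IsCoordinate.hasDerivAt {u : ℝ → ℝ} {p q c x : ℝ} (hu : IsCoordinate u p q c)
    (hx : x ∈ Icc p q) : HasDerivAt u (deriv u x) x :=
  (hu.analytic x hx).differentiableAt.hasDerivAt

lemma analyticAt_ofReal_comp {f : ℝ → ℝ} {x : ℝ} (hf : AnalyticAt ℝ f x) :
    AnalyticAt ℝ (fun y => (f y : ℂ)) x :=
  (Complex.ofRealCLM.analyticAt _).comp hf

/-- Division with remainder by a coordinate. -/
lemma IsCoordinate.exists_eq_add_mul {u : ℝ → ℝ} {p q c : ℝ} (hu : IsCoordinate u p q c)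
    {G : ℝ → ℂ} (hG : AnalyticOnNhd ℝ G (Icc p q)) :
    ∃ G₁ : ℝ → ℂ, AnalyticOnNhd ℝ G₁ (Icc p q) ∧ ∀ x ∈ Icc p q, G x = G c + u x * G₁ x := by
  have huc := hu.apply_eq_zero
  have hne : ∀ x ∈ Icc p q, dslope u c x ≠ 0 := by
    intro x hx
    rcases eq_or_ne x c with rfl | hxc
    · rw [dslope_same]
      exact hu.deriv_ne_zero x hx
    · obtain ⟨w, hw, hwpos⟩ := hu.sign x
      have h := sub_smul_dslope u c x
      rw [huc, sub_zero, hw, smul_eq_mul] at h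
      rw [mul_left_cancel₀ (sub_ne_zero.mpr hxc) h]
      exact (hwpos hx).ne'
  refine ⟨fun x => dslope G c x / ((dslope u c x : ℝ) : ℂ), fun x hx => ?_, fun x hx => ?_⟩
  · exact (analyticAt_dslope (hG x hx) c).div
      (analyticAt_ofReal_comp (analyticAt_dslope (hu.analytic x hx) c))
      (by exact_mod_cast hne x hx)
  · have h1 := sub_smul_dslope G c x
    have h2 := sub_smul_dslope u c x
    rw [huc, sub_zero, smul_eq_mul] at h2
    rw [Complex.real_smul] at h1
    have h3 : ((dslope u c x : ℝ) : ℂ) ≠ 0 := by exact_mod_cast hne x hx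
    rw [← h2]
    push_cast at h1 ⊢
    field_simp
    linear_combination -h1

/-! ### Oscillatory integrals in a normalizing coordinate -/

/-- The oscillating factor `exp (i T v ^ m)`. -/
noncomputable def oscPow (m : ℕ) (T v : ℝ) : ℂ := Complex.exp (Complex.I * T * (v : ℂ) ^ m)

lemma norm_oscPow (m : ℕ) (T v : ℝ) : ‖oscPow m T v‖ = 1 := by
  rw [oscPow, show Complex.I * T * (v : ℂ) ^ m = ((T * v ^ m : ℝ) : ℂ) * Complex.I by push_cast; ring,
    Complex.norm_exp_ofReal_mul_I]

lemma continuous_oscPow (m : ℕ) (T : ℝ) : Continuous (oscPow m T) := by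
  unfold oscPow
  fun_prop

lemma hasDerivAt_oscPow (k : ℕ) (T v : ℝ) :
    HasDerivAt (oscPow (k + 1) T)
      (oscPow (k + 1) T v * (Complex.I * T * ((k + 1) * (v : ℂ) ^ k))) v := by
  have h := (((hasDerivAt_pow (k + 1) (v : ℂ)).const_mul (Complex.I * T)).cexp).comp_ofReal
  push_cast [Nat.add_sub_cancel] at h
  exact h

section Coordinate

variable {u : ℝ → ℝ} {p q c : ℝ}

lemma IsCoordinate.le (hu : IsCoordinate u p q c) : p ≤ q := hu.mem.1.trans hu.mem.2

lemma IsCoordinate.continuousOn_deriv (hu : IsCoordinate u p q c) :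
    ContinuousOn (deriv u) (Icc p q) := hu.analytic.deriv.continuousOn

lemma IsCoordinate.continuousOn_oscPow (hu : IsCoordinate u p q c) (m : ℕ) (T : ℝ) :
    ContinuousOn (fun x => oscPow m T (u x)) (Icc p q) :=
  (continuous_oscPow m T).comp_continuousOn hu.analytic.continuousOn

lemma IsCoordinate.integral_pow_mul_oscPow (hu : IsCoordinate u p q c) (j m : ℕ) (T : ℝ) :
    ∫ x in p..q, (u x : ℂ) ^ j * (deriv u x) * oscPow m T (u x) =
      ∫ v in u p..u q, (v : ℂ) ^ j * oscPow m T v := by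
  have hI := uIcc_of_le hu.le
  rw [← intervalIntegral.integral_deriv_smul_comp (f := u) (f' := deriv u)
    (fun x hx => hu.hasDerivAt (hI ▸ hx)) (hI ▸ hu.continuousOn_deriv)
    (by have := continuous_oscPow m T
        fun_prop)]
  refine intervalIntegral.integral_congr fun x _ => ?_
  simp only [Function.comp, Complex.real_smul]
  ring

/-- Integration by parts against `u ^ k u' exp (i T u ^ (k + 1))`. -/
lemma IsCoordinate.integral_mul_pow_mul_oscPow (hu : IsCoordinate u p q c) {G : ℝ → ℂ}
    (hG : AnalyticOnNhd ℝ G (Icc p q)) (k : ℕ) {T : ℝ} (hT : 0 < T) :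
    ∫ x in p..q, G x * ((u x : ℂ) ^ k * (deriv u x) * oscPow (k + 1) T (u x)) =
      (Complex.I * T * (k + 1))⁻¹ * (G q * oscPow (k + 1) T (u q) - G p * oscPow (k + 1) T (u p) -
        ∫ x in p..q, deriv G x * oscPow (k + 1) T (u x)) := by
  have hI := uIcc_of_le hu.le
  have hk : (k : ℂ) + 1 ≠ 0 := by exact_mod_cast Nat.succ_ne_zero k
  have hT0 : (T : ℂ) ≠ 0 := by exact_mod_cast hT.ne'
  have hosc := hu.continuousOn_oscPow (k + 1) T
  have hu' : ContinuousOn (fun x => ((deriv u x : ℝ) : ℂ)) (Icc p q) :=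
    Complex.continuous_ofReal.comp_continuousOn hu.continuousOn_deriv
  have hu0 : ContinuousOn (fun x => ((u x : ℝ) : ℂ)) (Icc p q) :=
    Complex.continuous_ofReal.comp_continuousOn hu.analytic.continuousOn
  have h := intervalIntegral.integral_mul_deriv_eq_deriv_mul (a := p) (b := q)
    (u := G) (u' := deriv G) (v := fun x => oscPow (k + 1) T (u x))
    (v' := fun x => ((deriv u x : ℝ) : ℂ) *
      (oscPow (k + 1) T (u x) * (Complex.I * T * ((k + 1) * (u x : ℂ) ^ k))))
    (fun x hx => (hG x (hI ▸ hx)).differentiableAt.hasDerivAt)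
    (fun x hx => by
      simpa only [Complex.real_smul, Function.comp_def] using
        (hasDerivAt_oscPow k T (u x)).scomp x (hu.hasDerivAt (hI ▸ hx)))
    (ContinuousOn.intervalIntegrable (hI ▸ hG.deriv.continuousOn))
    (ContinuousOn.intervalIntegrable (by rw [hI]; fun_prop))
  rw [← h, ← intervalIntegral.integral_const_mul]
  refine intervalIntegral.integral_congr fun x _ => ?_
  field_simp

/-- A crude bound for integrals with a factor `u ^ k u'`. -/
lemma IsCoordinate.isBigO_integral_mul_pow_mul_oscPow (hu : IsCoordinate u p q c) {G : ℝ → ℂ}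
    (hG : AnalyticOnNhd ℝ G (Icc p q)) (k : ℕ) :
    (fun T : ℝ => ∫ x in p..q, G x * ((u x : ℂ) ^ k * (deriv u x) * oscPow (k + 1) T (u x)))
      =O[atTop] fun T : ℝ => T ^ (-1 : ℝ) := by
  refine IsBigO.of_bound (‖G q‖ + ‖G p‖ + ∫ x in p..q, ‖deriv G x‖) ?_
  filter_upwards [eventually_gt_atTop 0] with T hT
  have hI := uIcc_of_le hu.le
  rw [hu.integral_mul_pow_mul_oscPow hG k hT, norm_mul, mul_comm, Real.rpow_neg_one]
  refine mul_le_mul ?_ ?_ (norm_nonneg _) ?_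
  · refine (norm_sub_le _ _).trans <| add_le_add ((norm_sub_le _ _).trans (add_le_add ?_ ?_)) ?_
    · rw [norm_mul, norm_oscPow, mul_one]
    · rw [norm_mul, norm_oscPow, mul_one]
    · refine (intervalIntegral.norm_integral_le_integral_norm hu.le).trans (le_of_eq ?_)
      simp only [norm_mul, norm_oscPow, mul_one]
  · rw [norm_inv, norm_mul, norm_mul, Complex.norm_I, one_mul, Complex.norm_real, norm_inv]
    have h1 : (1 : ℝ) ≤ ‖(k : ℂ) + 1‖ := by
      have : (k : ℂ) + 1 = ((k + 1 : ℝ) : ℂ) := by push_cast; rfl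
      rw [this, Complex.norm_real, Real.norm_of_nonneg (by positivity)]
      have : (0 : ℝ) ≤ k := by positivity
      linarith
    have h2 : 0 < ‖T‖ := by simpa using hT.ne'
    gcongr
    exact le_mul_of_one_le_right h2.le h1
  · have : 0 ≤ ∫ x in p..q, ‖deriv G x‖ :=
      intervalIntegral.integral_nonneg hu.le fun _ _ => norm_nonneg _
    positivity

end Coordinate

lemma isBigO_const_mul_exp (k : ℕ) {B : ℝ} (hB : 0 < B) :
    (fun T : ℝ => (∫ v in (0 : ℝ)..B, oscPow (k + 1) T v) -
        (((T ^ (-(1 / (k + 1 : ℕ)) : ℝ) : ℝ) : ℂ) *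
            Complex.exp (Complex.I * ((1 / (k + 1 : ℕ) : ℝ) * (Real.pi / 2))) *
            (Real.Gamma (1 / (k + 1 : ℕ) + 1) : ℂ) +
          oscPow (k + 1) T B / (Complex.I * T * (k + 1) * (B : ℂ) ^ k)))
      =O[atTop] fun T : ℝ => T ^ (-2 : ℝ) := by
  obtain ⟨C, hC⟩ := exists_norm_fresnel_sub_le k hB
  refine IsBigO.of_bound C ?_
  filter_upwards [eventually_gt_atTop 0] with T hT
  refine (hC T hT).trans (le_of_eq ?_)
  rw [Real.rpow_neg hT.le, norm_inv, Real.norm_of_nonneg (by positivity), Real.rpow_two]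
  rfl

/-- `∫₀^B v exp (i T v³) dv = O(T ^ (-2 / 3))`. -/
lemma isBigO_integral_mul_oscPow_three {B : ℝ} (hB : 0 < B) :
    (fun T : ℝ => ∫ v in (0 : ℝ)..B, (v : ℂ) * oscPow 3 T v)
      =O[atTop] fun T : ℝ => T ^ (-(2 / 3) : ℝ) := by
  refine IsBigO.of_bound 2 ?_
  filter_upwards [eventually_gt_atTop 0, eventually_gt_atTop (B⁻¹ ^ 3)] with T hT hTB
  -- The scale at which the phase `T v³` reaches `1`. Below `d` the trivial bound is used, above it
  -- integration by parts.
  set d : ℝ := T ^ (-(1 / 3) : ℝ) with hd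
  have hdpos : 0 < d := by positivity
  have hd3 : T * d ^ 3 = 1 := by
    rw [hd, ← Real.rpow_natCast, ← Real.rpow_mul hT.le]
    norm_num
    rw [Real.rpow_neg_one, mul_inv_cancel₀ hT.ne']
  have hd2 : T ^ (-(2 / 3) : ℝ) = d ^ 2 := by
    rw [hd, ← Real.rpow_natCast, ← Real.rpow_mul hT.le]
    norm_num
  have hdB : d ≤ B := by
    by_contra h
    push Not at h
    have h1 : B ^ 3 < d ^ 3 := by gcongr
    have h2 : B⁻¹ ^ 3 * B ^ 3 = 1 := by field_simp
    have h3 : B⁻¹ ^ 3 * B ^ 3 < T * d ^ 3 := by gcongr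
    rw [h2, hd3] at h3
    exact lt_irrefl _ h3
  have hcont : Continuous fun v : ℝ => (v : ℂ) * oscPow 3 T v := by
    have := continuous_oscPow 3 T
    fun_prop
  rw [hd2, Real.norm_of_nonneg (by positivity),
    ← intervalIntegral.integral_add_adjacent_intervals (hcont.intervalIntegrable 0 d)
      (hcont.intervalIntegrable d B)]
  have hT0 : (T : ℂ) ≠ 0 := by exact_mod_cast hT.ne'
  have hnear : ‖∫ v in (0 : ℝ)..d, (v : ℂ) * oscPow 3 T v‖ ≤ d ^ 2 := by
    have h := intervalIntegral.norm_integral_le_of_norm_le_const (a := 0) (b := d) (C := d)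
      (f := fun v : ℝ => (v : ℂ) * oscPow 3 T v) (fun v hv => by
        rw [uIoc_of_le hdpos.le] at hv
        rw [norm_mul, norm_oscPow, mul_one, Complex.norm_real, Real.norm_of_nonneg hv.1.le]
        exact hv.2)
    rw [sub_zero, abs_of_pos hdpos] at h
    linarith [sq d]
  have hne : ∀ v ∈ uIcc d B, (v : ℂ) ≠ 0 := by
    intro v hv
    rw [uIcc_of_le hdB] at hv
    exact_mod_cast (hdpos.trans_le hv.1).ne'
  -- Integration by parts with `v = v² / v`: the factor `v² exp (i T v³)` is an exact derivative up
  -- to `3 i T`, and the leftover `v⁻²` integrates to at most `1/d`. Since `1 / (T d) = d²`, the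
  -- bound is again of order `d²`.
  have hderiv : ∀ v ∈ uIcc d B, HasDerivAt
      (fun v : ℝ => oscPow 3 T v * (v : ℂ)⁻¹)
      (oscPow 3 T v * (Complex.I * T * (((2 : ℕ) + 1) * (v : ℂ) ^ 2)) * (v : ℂ)⁻¹ +
        oscPow 3 T v * (-((v : ℂ) ^ 2)⁻¹)) v := fun v hv =>
    (hasDerivAt_oscPow 2 T v).mul (hasDerivAt_inv (hne v hv)).comp_ofReal
  have hc1 : ContinuousOn (fun v : ℝ => oscPow 3 T v * (-((v : ℂ) ^ 2)⁻¹)) (uIcc d B) := by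
    refine (continuous_oscPow 3 T).continuousOn.mul (ContinuousOn.neg (ContinuousOn.inv₀ ?_ ?_))
    · fun_prop
    · exact fun v hv => pow_ne_zero _ (hne v hv)
  have hc2 : ContinuousOn (fun v : ℝ => oscPow 3 T v *
      (Complex.I * T * (((2 : ℕ) + 1) * (v : ℂ) ^ 2)) * (v : ℂ)⁻¹) (uIcc d B) := by
    have := (continuous_oscPow 3 T).continuousOn (s := uIcc d B)
    refine ContinuousOn.mul (by fun_prop) (ContinuousOn.inv₀ (by fun_prop) hne)
  have hFTC := intervalIntegral.integral_eq_sub_of_hasDerivAt hderiv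
    (ContinuousOn.intervalIntegrable (hc2.add hc1))
  rw [intervalIntegral.integral_add hc2.intervalIntegrable hc1.intervalIntegrable] at hFTC
  have hint : ∫ v in d..B, oscPow 3 T v * (Complex.I * T * (((2 : ℕ) + 1) * (v : ℂ) ^ 2)) *
      (v : ℂ)⁻¹ = (Complex.I * T * 3) * ∫ v in d..B, (v : ℂ) * oscPow 3 T v := by
    rw [← intervalIntegral.integral_const_mul]
    refine intervalIntegral.integral_congr fun v hv => ?_
    have := hne v hv
    push_cast
    field_simp
    ring
  rw [hint] at hFTC
  have hrest : ‖∫ v in d..B, oscPow 3 T v * (-((v : ℂ) ^ 2)⁻¹)‖ ≤ d⁻¹ - B⁻¹ := by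
    have hr : ∫ v in d..B, (v ^ 2)⁻¹ = d⁻¹ - B⁻¹ := by
      have h := intervalIntegral.integral_eq_sub_of_hasDerivAt (a := d) (b := B)
        (f := fun v : ℝ => -v⁻¹) (f' := fun v => (v ^ 2)⁻¹) (fun v hv => by
          rw [uIcc_of_le hdB] at hv
          simpa using (hasDerivAt_inv (hdpos.trans_le hv.1).ne').fun_neg)
        (ContinuousOn.intervalIntegrable (ContinuousOn.inv₀ (by fun_prop) fun v hv => by
          rw [uIcc_of_le hdB] at hv
          exact pow_ne_zero _ (hdpos.trans_le hv.1).ne'))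
      rw [h]
      ring
    rw [← hr]
    refine (intervalIntegral.norm_integral_le_integral_norm hdB).trans (le_of_eq ?_)
    refine intervalIntegral.integral_congr fun v _ => ?_
    simp [norm_oscPow]
  have hfar : ‖∫ v in d..B, (v : ℂ) * oscPow 3 T v‖ ≤ d ^ 2 := by
    have h1 : (Complex.I * T * 3) * ∫ v in d..B, (v : ℂ) * oscPow 3 T v =
        oscPow 3 T B * (B : ℂ)⁻¹ - oscPow 3 T d * (d : ℂ)⁻¹ -
          ∫ v in d..B, oscPow 3 T v * (-((v : ℂ) ^ 2)⁻¹) := by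
      linear_combination hFTC
    have h2 := congrArg norm h1
    rw [norm_mul, norm_mul, norm_mul, Complex.norm_I, one_mul, Complex.norm_real,
      Real.norm_of_nonneg hT.le] at h2
    have h3 : ‖oscPow 3 T B * (B : ℂ)⁻¹ - oscPow 3 T d * (d : ℂ)⁻¹ -
          ∫ v in d..B, oscPow 3 T v * (-((v : ℂ) ^ 2)⁻¹)‖ ≤ B⁻¹ + d⁻¹ + (d⁻¹ - B⁻¹) := by
      refine (norm_sub_le _ _).trans <| add_le_add ((norm_sub_le _ _).trans (add_le_add ?_ ?_)) hrest
      · rw [norm_mul, norm_oscPow, one_mul, norm_inv, Complex.norm_real, Real.norm_of_nonneg hB.le]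
      · rw [norm_mul, norm_oscPow, one_mul, norm_inv, Complex.norm_real,
          Real.norm_of_nonneg hdpos.le]
    have h4 : d⁻¹ = T * d ^ 2 := by
      field_simp
      linarith [hd3]
    rw [← h2, h4] at h3
    simp only [Complex.norm_ofNat] at h3
    have h5 : T * (3 * ‖∫ v in d..B, (v : ℂ) * oscPow 3 T v‖) ≤ T * (2 * d ^ 2) := by linarith
    have h6 := le_of_mul_le_mul_left h5 hT
    have h7 : 0 ≤ d ^ 2 := by positivity
    linarith
  exact (norm_add_le _ _).trans (by linarith)

lemma isBigO_rpow_rpow {s t : ℝ} (h : s ≤ t) :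
    (fun T : ℝ => T ^ s) =O[atTop] fun T : ℝ => T ^ t := by
  refine IsBigO.of_bound 1 ?_
  filter_upwards [eventually_ge_atTop 1] with T hT
  rw [one_mul, Real.norm_of_nonneg (by positivity), Real.norm_of_nonneg (by positivity)]
  exact Real.rpow_le_rpow_of_exponent_le hT h

lemma isBigO_ofReal_rpow_mul (s : ℝ) (w : ℂ) :
    (fun T : ℝ => ((T ^ s : ℝ) : ℂ) * w) =O[atTop] fun T : ℝ => T ^ s := by
  refine IsBigO.of_bound ‖w‖ (Eventually.of_forall fun T => ?_)
  rw [norm_mul, Complex.norm_real, mul_comm]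

lemma isBigO_oscPow_div (m : ℕ) (v : ℝ) (w : ℂ) :
    (fun T : ℝ => oscPow m T v * w / T) =O[atTop] fun T : ℝ => T ^ (-1 : ℝ) := by
  refine IsBigO.of_bound ‖w‖ (Eventually.of_forall fun T => ?_)
  rw [norm_div, norm_mul, norm_oscPow, one_mul, Complex.norm_real, Real.rpow_neg_one, norm_inv,
    div_eq_mul_inv]

lemma oscPow_two_neg (T v : ℝ) : oscPow 2 T (-v) = oscPow 2 T v := by
  simp [oscPow]

lemma Gamma_three_halves : Real.Gamma (1 / 2 + 1) = √Real.pi / 2 := by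
  rw [Real.Gamma_add_one (by norm_num), Real.Gamma_one_half_eq]
  ring

/-- Two-sided Fresnel integral, up to and including the endpoint contributions. -/
lemma isBigO_integral_oscPow_two {A B : ℝ} (hA : A < 0) (hB : 0 < B) :
    (fun T : ℝ => (∫ v in A..B, oscPow 2 T v) -
        (((T ^ (-(1 / 2) : ℝ) : ℝ) : ℂ) * (Complex.exp (Complex.I * (Real.pi / 4)) * √Real.pi) +
          oscPow 2 T B / (2 * Complex.I * T * B) - oscPow 2 T A / (2 * Complex.I * T * A)))
      =O[atTop] fun T : ℝ => T ^ (-2 : ℝ) := by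
  have h := (isBigO_const_mul_exp 1 hB).add (isBigO_const_mul_exp 1 (neg_pos.mpr hA))
  refine h.congr_left fun T => ?_
  -- Evenness of `v²` folds the left half onto `[0, -A]`, so two one-sided expansions suffice.
  have h1 : ∫ v in (0 : ℝ)..-A, oscPow 2 T v = ∫ v in A..0, oscPow 2 T v := by
    have h2 := intervalIntegral.integral_comp_neg (a := A) (b := 0) (fun v => oscPow 2 T v)
    rw [neg_zero] at h2
    rw [← h2]
    simp only [oscPow_two_neg]
  have hi : ∀ a b : ℝ, IntervalIntegrable (oscPow 2 T) volume a b :=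
    fun a b => (continuous_oscPow 2 T).intervalIntegrable a b
  rw [← intervalIntegral.integral_add_adjacent_intervals (hi A 0) (hi 0 B)]
  have h3 : (1 : ℝ) / ((1 + 1 : ℕ) : ℝ) = 1 / 2 := by norm_num
  simp only [h3, Gamma_three_halves, Nat.reduceAdd, h1, oscPow_two_neg]
  push_cast
  rw [show (1 : ℂ) / 2 * (Real.pi / 2) = Real.pi / 4 by ring]
  have hA' : (A : ℂ) ≠ 0 := by exact_mod_cast hA.ne
  have hB' : (B : ℂ) ≠ 0 := by exact_mod_cast hB.ne'
  rcases eq_or_ne (T : ℂ) 0 with hT | hT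
  · simp only [hT]
    ring
  · field_simp
    ring

lemma isBigO_integral_oscPow_two' {A B : ℝ} (hA : A < 0) (hB : 0 < B) :
    (fun T : ℝ => ∫ v in A..B, oscPow 2 T v) =O[atTop] fun T : ℝ => T ^ (-(1 / 2) : ℝ) := by
  have h1 := (isBigO_integral_oscPow_two hA hB).trans (isBigO_rpow_rpow (t := -(1 / 2))
    (by norm_num))
  have h2 := isBigO_ofReal_rpow_mul (-(1 / 2))
    (Complex.exp (Complex.I * (Real.pi / 4)) * √Real.pi)
  have h3 := (isBigO_oscPow_div 2 B (2 * Complex.I * B)⁻¹).trans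
    (isBigO_rpow_rpow (t := -(1 / 2)) (by norm_num))
  have h4 := (isBigO_oscPow_div 2 A (2 * Complex.I * A)⁻¹).trans
    (isBigO_rpow_rpow (t := -(1 / 2)) (by norm_num))
  refine (((h1.add h2).add h3).sub h4).congr_left fun T => ?_
  simp only [div_eq_mul_inv, mul_inv]
  ring

section Coordinate

variable {u : ℝ → ℝ} {p q c : ℝ}

lemma IsCoordinate.neg_of_lt (hu : IsCoordinate u p q c) (h : p < c) : u p < 0 := by
  obtain ⟨w, hw, hpos⟩ := hu.sign p
  rw [hw]
  exact mul_neg_of_neg_of_pos (by linarith) (hpos (left_mem_Icc.mpr hu.le))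

lemma IsCoordinate.pos_of_lt (hu : IsCoordinate u p q c) (h : c < q) : 0 < u q := by
  obtain ⟨w, hw, hpos⟩ := hu.sign q
  rw [hw]
  exact mul_pos (by linarith) (hpos (right_mem_Icc.mpr hu.le))

lemma IsCoordinate.intervalIntegrable (hu : IsCoordinate u p q c) {G : ℝ → ℂ}
    (hG : AnalyticOnNhd ℝ G (Icc p q)) (j m : ℕ) (T : ℝ) :
    IntervalIntegrable (fun x => G x * ((u x : ℂ) ^ j * (deriv u x) * oscPow m T (u x)))
      volume p q := by
  refine ContinuousOn.intervalIntegrable ?_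
  rw [uIcc_of_le hu.le]
  have hosc := hu.continuousOn_oscPow m T
  have hu' : ContinuousOn (fun x => ((deriv u x : ℝ) : ℂ)) (Icc p q) :=
    Complex.continuous_ofReal.comp_continuousOn hu.continuousOn_deriv
  have hu0 : ContinuousOn (fun x => ((u x : ℝ) : ℂ)) (Icc p q) :=
    Complex.continuous_ofReal.comp_continuousOn hu.analytic.continuousOn
  have := hG.continuousOn
  fun_prop

/-- Division with remainder under the integral sign. -/
lemma IsCoordinate.integral_eq_add (hu : IsCoordinate u p q c) {G G₁ : ℝ → ℂ}
    (hG₁ : AnalyticOnNhd ℝ G₁ (Icc p q)) (h : ∀ x ∈ Icc p q, G x = G c + u x * G₁ x)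
    (j m : ℕ) (T : ℝ) :
    ∫ x in p..q, G x * ((u x : ℂ) ^ j * (deriv u x) * oscPow m T (u x)) =
      G c * (∫ v in u p..u q, (v : ℂ) ^ j * oscPow m T v) +
        ∫ x in p..q, G₁ x * ((u x : ℂ) ^ (j + 1) * (deriv u x) * oscPow m T (u x)) := by
  rw [← hu.integral_pow_mul_oscPow, ← intervalIntegral.integral_const_mul,
    ← intervalIntegral.integral_add
      (hu.intervalIntegrable (G := fun _ => G c) analyticOnNhd_const j m T)
      (hu.intervalIntegrable hG₁ (j + 1) m T)]
  refine intervalIntegral.integral_congr fun x hx => ?_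
  rw [h x (uIcc_of_le hu.le ▸ hx)]
  ring

lemma IsCoordinate.analyticOnNhd_div_deriv (hu : IsCoordinate u p q c) {G : ℝ → ℂ}
    (hG : AnalyticOnNhd ℝ G (Icc p q)) :
    AnalyticOnNhd ℝ (fun x => G x / ((deriv u x : ℝ) : ℂ)) (Icc p q) := fun x hx =>
  (hG x hx).div (analyticAt_ofReal_comp (hu.analytic.deriv x hx))
    (by exact_mod_cast hu.deriv_ne_zero x hx)

lemma IsCoordinate.integral_div_deriv (hu : IsCoordinate u p q c) (G E : ℝ → ℂ) :
    ∫ x in p..q, G x * E x =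
      ∫ x in p..q, G x / ((deriv u x : ℝ) : ℂ) * ((u x : ℂ) ^ 0 * (deriv u x) * E x) := by
  refine intervalIntegral.integral_congr fun x hx => ?_
  have : ((deriv u x : ℝ) : ℂ) ≠ 0 := by
    exact_mod_cast hu.deriv_ne_zero x (uIcc_of_le hu.le ▸ hx)
  simp only [pow_zero, one_mul]
  field_simp

/-- Crude order of magnitude, used to bound what is left after one integration by parts in the
refined expansion `isBigO_integral_two_sub`. -/
lemma IsCoordinate.isBigO_integral_two (hu : IsCoordinate u p q c) (hpc : p < c) (hcq : c < q)
    {G : ℝ → ℂ} (hG : AnalyticOnNhd ℝ G (Icc p q)) :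
    (fun T : ℝ => ∫ x in p..q, G x * ((u x : ℂ) ^ 0 * (deriv u x) * oscPow 2 T (u x)))
      =O[atTop] fun T : ℝ => T ^ (-(1 / 2) : ℝ) := by
  obtain ⟨G₁, hG₁, h⟩ := hu.exists_eq_add_mul hG
  have h1 := (isBigO_integral_oscPow_two' (hu.neg_of_lt hpc) (hu.pos_of_lt hcq)).const_mul_left
    (G c)
  have h2 := (hu.isBigO_integral_mul_pow_mul_oscPow hG₁ 1).trans
    (isBigO_rpow_rpow (t := -(1 / 2)) (by norm_num))
  refine (h1.add h2).congr_left fun T => ?_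
  rw [hu.integral_eq_add hG₁ h]
  simp only [pow_zero, one_mul, zero_add]

lemma IsCoordinate.isBigO_integral_two_sub (hu : IsCoordinate u p q c) (hpc : p < c) (hcq : c < q)
    {G : ℝ → ℂ} (hG : AnalyticOnNhd ℝ G (Icc p q)) :
    (fun T : ℝ => (∫ x in p..q, G x * ((u x : ℂ) ^ 0 * (deriv u x) * oscPow 2 T (u x))) -
        (G c * (((T ^ (-(1 / 2) : ℝ) : ℝ) : ℂ) *
            (Complex.exp (Complex.I * (Real.pi / 4)) * √Real.pi)) +
          (G q * oscPow 2 T (u q) / (2 * Complex.I * T * u q) -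
            G p * oscPow 2 T (u p) / (2 * Complex.I * T * u p))))
      =O[atTop] fun T : ℝ => T ^ (-(3 / 2) : ℝ) := by
  obtain ⟨G₁, hG₁, h⟩ := hu.exists_eq_add_mul hG
  have hp := hu.neg_of_lt hpc
  have hq := hu.pos_of_lt hcq
  have h1 := ((isBigO_integral_oscPow_two hp hq).const_mul_left (G c)).trans
    (isBigO_rpow_rpow (t := -(3 / 2)) (by norm_num))
  -- After integration by parts, `G₁'` stands under an integral of the original type, so the error
  -- is `T^{-1}` times `T^{-1/2}`.
  have h2 : (fun T : ℝ => (2 * Complex.I * T)⁻¹ * ∫ x in p..q, deriv G₁ x * oscPow 2 T (u x))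
      =O[atTop] fun T : ℝ => T ^ (-(3 / 2) : ℝ) := by
    have h3 := hu.isBigO_integral_two hpc hcq (hu.analyticOnNhd_div_deriv hG₁.deriv)
    simp only [← hu.integral_div_deriv] at h3
    have h4 := isBigO_ofReal_rpow_mul (-1) (2 * Complex.I)⁻¹
    refine (h4.mul h3).congr' ?_ ?_
    · filter_upwards with T
      rw [Real.rpow_neg_one]
      push_cast
      rw [mul_inv]
      ring
    · filter_upwards [eventually_gt_atTop 0] with T hT
      rw [← Real.rpow_add hT]
      norm_num
  refine (h1.sub h2).congr' ?_ EventuallyEq.rfl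
  filter_upwards [eventually_gt_atTop 0] with T hT
  rw [hu.integral_eq_add hG₁ h, hu.integral_mul_pow_mul_oscPow hG₁ 1 hT]
  have hT' : (T : ℂ) ≠ 0 := by exact_mod_cast hT.ne'
  have hp' : (u p : ℂ) ≠ 0 := by exact_mod_cast hp.ne
  have hq' : (u q : ℂ) ≠ 0 := by exact_mod_cast hq.ne'
  -- At each endpoint the Fresnel boundary term, with coefficient `G c`, and the
  -- integration-by-parts boundary term, with `u * G₁`, recombine into `G` over `2 i T u`.
  have e1 := h p (left_mem_Icc.mpr hu.le)
  have e2 := h q (right_mem_Icc.mpr hu.le)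
  simp only [pow_zero, one_mul, Nat.reduceAdd]
  rw [e1, e2]
  push_cast
  field_simp
  ring

/-- Here `G = G(p) + G₁(p) u + G₂ u²`. The linear term already has size `T^{-2/3}`, which fixes the
error. The quadratic term carries the factor `u² u'` and is `O(T^{-1})`, as is the Fresnel boundary
term at `q`. -/
lemma IsCoordinate.isBigO_integral_three_sub (hu : IsCoordinate u p q p) (hpq : p < q)
    {G : ℝ → ℂ} (hG : AnalyticOnNhd ℝ G (Icc p q)) :
    (fun T : ℝ => (∫ x in p..q, G x * ((u x : ℂ) ^ 0 * (deriv u x) * oscPow 3 T (u x))) -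
        G p * (((T ^ (-(1 / 3) : ℝ) : ℝ) : ℂ) *
            (Complex.exp (Complex.I * (Real.pi / 6)) * (Real.Gamma (1 / 3 + 1) : ℝ))))
      =O[atTop] fun T : ℝ => T ^ (-(2 / 3) : ℝ) := by
  obtain ⟨G₁, hG₁, h₁⟩ := hu.exists_eq_add_mul hG
  obtain ⟨G₂, hG₂, h₂⟩ := hu.exists_eq_add_mul hG₁
  have hq := hu.pos_of_lt hpq
  have hup := hu.apply_eq_zero
  have a1 := ((isBigO_const_mul_exp 2 hq).const_mul_left (G p)).trans
    (isBigO_rpow_rpow (t := -(2 / 3)) (by norm_num))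
  have a2 := (isBigO_integral_mul_oscPow_three hq).const_mul_left (G₁ p)
  have a3 := (hu.isBigO_integral_mul_pow_mul_oscPow hG₂ 2).trans
    (isBigO_rpow_rpow (t := -(2 / 3)) (by norm_num))
  have a4 := (isBigO_oscPow_div 3 (u q) (G p / (3 * Complex.I * (u q) ^ 2))).trans
    (isBigO_rpow_rpow (t := -(2 / 3)) (by norm_num))
  refine (((a1.add a2).add a3).add a4).congr_left fun T => ?_
  rw [hu.integral_eq_add hG₁ h₁, hu.integral_eq_add hG₂ h₂, hup]
  have h3 : (1 : ℝ) / ((2 + 1 : ℕ) : ℝ) = 1 / 3 := by norm_num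
  simp only [h3, pow_zero, one_mul, zero_add, Nat.reduceAdd, pow_one]
  push_cast
  rw [show (1 : ℂ) / 3 * (Real.pi / 2) = Real.pi / 6 by ring]
  have hq' : (u q : ℂ) ≠ 0 := by exact_mod_cast hq.ne'
  rcases eq_or_ne (T : ℂ) 0 with hT | hT
  · simp only [hT]
    ring
  · field_simp
    ring

end Coordinate

/-! ### Stationary phase theorems -/

/-- Method of stationary phase: one nondegenerate interior minimum of the phase, with the
contribution of both endpoints. -/
theorem isBigO_stationary_phase {g : ℝ → ℂ} {H : ℝ → ℝ} {p q c ℓ : ℝ} (hpc : p < c) (hcq : c < q)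
    (hg : AnalyticOnNhd ℝ g (Icc p q)) (hH : AnalyticOnNhd ℝ H (Icc p q)) (hℓ : 0 < ℓ)
    (hlim : Tendsto (fun x => deriv H x / (x - c)) (𝓝[≠] c) (𝓝 ℓ))
    (hsign : ∀ x ∈ Icc p q, x ≠ c → 0 < deriv H x / (x - c)) :
    (fun T : ℝ => (∫ x in p..q, g x * Complex.exp (Complex.I * T * H x)) -
        (g c * Complex.exp (Complex.I * T * H c) * Complex.exp (Complex.I * (Real.pi / 4)) *
            (√(2 * Real.pi / (T * ℓ)) : ℝ) +
          (g q * Complex.exp (Complex.I * T * H q) / (Complex.I * T * deriv H q) -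
            g p * Complex.exp (Complex.I * T * H p) / (Complex.I * T * deriv H p))))
      =O[atTop] fun T : ℝ => T ^ (-(3 / 2) : ℝ) := by
  obtain ⟨u, hu, hHu, huc⟩ := exists_coordinate ⟨hpc.le, hcq.le⟩ hH 1 hℓ
    (by simpa only [pow_one] using hlim) (by simpa only [pow_one] using hsign)
  have hkey := hu.isBigO_integral_two_sub hpc hcq (hu.analyticOnNhd_div_deriv hg)
  simp only [← hu.integral_div_deriv] at hkey
  have hphase : (fun T : ℝ => Complex.exp (Complex.I * T * H c)) =O[atTop] fun _ => (1 : ℝ) := by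
    refine IsBigO.of_bound 1 (Eventually.of_forall fun T => ?_)
    rw [show Complex.I * T * H c = ((T * H c : ℝ) : ℂ) * Complex.I by push_cast; ring,
      Complex.norm_exp_ofReal_mul_I]
    simp
  have hexp : ∀ x ∈ Icc p q, ∀ T : ℝ, Complex.exp (Complex.I * T * H x) =
      Complex.exp (Complex.I * T * H c) * oscPow 2 T (u x) := by
    intro x hx T
    have h := (hHu x hx).eq_of_nhds
    rw [oscPow, ← Complex.exp_add, h]
    push_cast
    ring_nf
  have hderiv : ∀ x ∈ Icc p q, deriv H x = 2 * u x * deriv u x := by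
    intro x hx
    rw [(hHu x hx).deriv_eq]
    have h := (((hu.hasDerivAt hx).fun_pow 2).const_add (H c)).deriv
    rw [h]
    push_cast
    ring
  have hint : ∀ T : ℝ, ∫ x in p..q, g x * Complex.exp (Complex.I * T * H x) =
      Complex.exp (Complex.I * T * H c) * ∫ x in p..q, g x * oscPow 2 T (u x) := by
    intro T
    rw [← intervalIntegral.integral_const_mul]
    refine intervalIntegral.integral_congr fun x hx => ?_
    rw [hexp x (uIcc_of_le hu.le ▸ hx) T]
    ring
  have hpm : p ∈ Icc p q := left_mem_Icc.mpr hu.le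
  have hqm : q ∈ Icc p q := right_mem_Icc.mpr hu.le
  refine (hphase.mul hkey).congr' ?_ (by simp only [one_mul]; exact EventuallyEq.rfl)
  filter_upwards [eventually_gt_atTop 0] with T hT
  rw [hint, hexp p hpm, hexp q hqm, hderiv p hpm, hderiv q hqm, huc]
  -- Division by `u'(c) = √(ℓ/2)` turns `√(π/T)` into the usual factor `√(2π/(Tℓ))`.
  have hsq : ((T ^ (-(1 / 2) : ℝ) : ℝ) : ℂ) * (√Real.pi : ℝ) =
      (√(2 * Real.pi / (T * ℓ)) : ℝ) * (((ℓ / ((1 : ℕ) + 1)) ^ (1 / ((1 : ℕ) + 1) : ℝ) : ℝ) : ℂ) := by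
    norm_cast
    rw [Real.rpow_neg hT.le, ← Real.sqrt_eq_rpow]
    norm_num
    rw [← Real.sqrt_eq_rpow, ← Real.sqrt_inv, ← Real.sqrt_mul (by positivity),
      ← Real.sqrt_mul (by positivity)]
    congr 1
    field_simp
  have hne : (((ℓ / ((1 : ℕ) + 1)) ^ (1 / ((1 : ℕ) + 1) : ℝ) : ℝ) : ℂ) ≠ 0 := by
    exact_mod_cast (by positivity : (0 : ℝ) < (ℓ / ((1 : ℕ) + 1)) ^ (1 / ((1 : ℕ) + 1) : ℝ)).ne'
  have hgc : g c / (((ℓ / ((1 : ℕ) + 1)) ^ (1 / ((1 : ℕ) + 1) : ℝ) : ℝ) : ℂ) *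
      (((T ^ (-(1 / 2) : ℝ) : ℝ) : ℂ) * (Complex.exp (Complex.I * (Real.pi / 4)) * √Real.pi)) =
      g c * Complex.exp (Complex.I * (Real.pi / 4)) * (√(2 * Real.pi / (T * ℓ)) : ℝ) := by
    rw [div_mul_eq_mul_div, div_eq_iff hne]
    linear_combination g c * Complex.exp (Complex.I * (Real.pi / 4)) * hsq
  rw [hgc]
  push_cast
  have hT' : (T : ℂ) ≠ 0 := by exact_mod_cast hT.ne'
  have hp' : (u p : ℂ) ≠ 0 := by exact_mod_cast (hu.neg_of_lt hpc).ne
  have hq' : (u q : ℂ) ≠ 0 := by exact_mod_cast (hu.pos_of_lt hcq).ne'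
  have hp2 : ((deriv u p : ℝ) : ℂ) ≠ 0 := by exact_mod_cast hu.deriv_ne_zero p hpm
  have hq2 : ((deriv u q : ℝ) : ℂ) ≠ 0 := by exact_mod_cast hu.deriv_ne_zero q hqm
  field_simp

/-- Method of stationary phase: a critical point of order two at the left endpoint. -/
theorem isBigO_stationary_phase_endpoint {g : ℝ → ℂ} {H : ℝ → ℝ} {p q ℓ : ℝ} (hpq : p < q)
    (hg : AnalyticOnNhd ℝ g (Icc p q)) (hH : AnalyticOnNhd ℝ H (Icc p q)) (hℓ : 0 < ℓ)
    (hlim : Tendsto (fun x => deriv H x / (x - p) ^ 2) (𝓝[≠] p) (𝓝 ℓ))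
    (hsign : ∀ x ∈ Icc p q, x ≠ p → 0 < deriv H x / (x - p) ^ 2) :
    (fun T : ℝ => (∫ x in p..q, g x * Complex.exp (Complex.I * T * H x)) -
        g p * Complex.exp (Complex.I * T * H p) * Complex.exp (Complex.I * (Real.pi / 6)) *
            (Real.Gamma (1 / 3 + 1) * (3 / (T * ℓ)) ^ (1 / 3 : ℝ) : ℝ))
      =O[atTop] fun T : ℝ => T ^ (-(2 / 3) : ℝ) := by
  obtain ⟨u, hu, hHu, huc⟩ := exists_coordinate ⟨le_rfl, hpq.le⟩ hH 2 hℓ hlim hsign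
  have hkey := hu.isBigO_integral_three_sub hpq (hu.analyticOnNhd_div_deriv hg)
  simp only [← hu.integral_div_deriv] at hkey
  have hphase : (fun T : ℝ => Complex.exp (Complex.I * T * H p)) =O[atTop] fun _ => (1 : ℝ) := by
    refine IsBigO.of_bound 1 (Eventually.of_forall fun T => ?_)
    rw [show Complex.I * T * H p = ((T * H p : ℝ) : ℂ) * Complex.I by push_cast; ring,
      Complex.norm_exp_ofReal_mul_I]
    simp
  have hint : ∀ T : ℝ, ∫ x in p..q, g x * Complex.exp (Complex.I * T * H x) =
      Complex.exp (Complex.I * T * H p) * ∫ x in p..q, g x * oscPow 3 T (u x) := by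
    intro T
    rw [← intervalIntegral.integral_const_mul]
    refine intervalIntegral.integral_congr fun x hx => ?_
    have h := (hHu x (uIcc_of_le hu.le ▸ hx)).eq_of_nhds
    rw [oscPow, mul_left_comm, ← Complex.exp_add, h]
    push_cast
    ring_nf
  refine (hphase.mul hkey).congr' ?_ (by simp only [one_mul]; exact EventuallyEq.rfl)
  filter_upwards [eventually_gt_atTop 0] with T hT
  rw [hint, huc]
  have hcb : ((T ^ (-(1 / 3) : ℝ) : ℝ) : ℂ) =
      (((3 / (T * ℓ)) ^ (1 / 3 : ℝ) : ℝ) : ℂ) *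
        (((ℓ / ((2 : ℕ) + 1)) ^ (1 / ((2 : ℕ) + 1) : ℝ) : ℝ) : ℂ) := by
    norm_cast
    rw [Real.rpow_neg hT.le, ← Real.inv_rpow hT.le]
    norm_num
    rw [← Real.mul_rpow (by positivity) (by positivity)]
    congr 1
    field_simp
  have hne : (((ℓ / ((2 : ℕ) + 1)) ^ (1 / ((2 : ℕ) + 1) : ℝ) : ℝ) : ℂ) ≠ 0 := by
    exact_mod_cast (by positivity : (0 : ℝ) < (ℓ / ((2 : ℕ) + 1)) ^ (1 / ((2 : ℕ) + 1) : ℝ)).ne'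
  have hgc : g p / (((ℓ / ((2 : ℕ) + 1)) ^ (1 / ((2 : ℕ) + 1) : ℝ) : ℝ) : ℂ) *
      (((T ^ (-(1 / 3) : ℝ) : ℝ) : ℂ) *
        (Complex.exp (Complex.I * (Real.pi / 6)) * (Real.Gamma (1 / 3 + 1) : ℝ))) =
      g p * Complex.exp (Complex.I * (Real.pi / 6)) *
        (Real.Gamma (1 / 3 + 1) * (3 / (T * ℓ)) ^ (1 / 3 : ℝ) : ℝ) := by
    rw [div_mul_eq_mul_div, div_eq_iff hne, hcb]
    push_cast
    ring
  rw [hgc]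
  ring

/-! ### Phase and amplitude on the unit circle -/

/-- The logarithm of `1 - λ z` at `z = e^{iφ}`. -/
noncomputable def logFactor (lam φ : ℝ) : ℂ := Complex.log (1 - (lam : ℂ) * circlePt φ)

/-- A continuous branch of the phase. -/
noncomputable def contPhase (lam a φ : ℝ) : ℝ := a * φ + 2 * (logFactor lam φ).im

/-- The amplitude relative to the continuous phase. -/
noncomputable def contAmplitude (lam α β φ : ℝ) : ℂ :=
  Complex.exp (Complex.I * (α * φ) + β * logFactor lam φ - conj (logFactor lam φ))

/-- The squared modulus of `1 - λ z` at `z = e^{iφ}`. -/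
noncomputable def sqModulus (lam φ : ℝ) : ℝ := 1 - 2 * lam * Real.cos φ + lam ^ 2

lemma circlePt_re (φ : ℝ) : (circlePt φ).re = Real.cos φ := Complex.exp_ofReal_mul_I_re φ

lemma circlePt_im (φ : ℝ) : (circlePt φ).im = Real.sin φ := Complex.exp_ofReal_mul_I_im φ

lemma circlePt_zero : circlePt 0 = 1 := by simp [circlePt]

lemma circlePt_pi : circlePt Real.pi = -1 := by simp [circlePt]

lemma circlePt_mul_conj (φ : ℝ) : circlePt φ * conj (circlePt φ) = 1 := by
  rw [Complex.mul_conj, Complex.normSq_eq_norm_sq, circlePt, Complex.norm_exp_ofReal_mul_I]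
  simp

lemma circlePt_cpow {φ : ℝ} (hφ : φ ∈ Ioc (-Real.pi) Real.pi) (s : ℂ) :
    circlePt φ ^ s = Complex.exp (s * (φ * Complex.I)) := by
  rw [circlePt, Complex.cpow_def_of_ne_zero (Complex.exp_ne_zero _),
    Complex.log_exp (by simpa using hφ.1) (by simpa using hφ.2), mul_comm]

lemma normSq_one_sub (lam φ : ℝ) :
    Complex.normSq (1 - (lam : ℂ) * circlePt φ) = sqModulus lam φ := by
  rw [Complex.normSq_apply, sqModulus]
  simp only [Complex.sub_re, Complex.sub_im, Complex.one_re, Complex.one_im,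
    Complex.re_ofReal_mul, Complex.im_ofReal_mul, circlePt_re, circlePt_im]
  linear_combination lam ^ 2 * Real.sin_sq_add_cos_sq φ

lemma hasDerivAt_circlePt (φ : ℝ) : HasDerivAt circlePt (circlePt φ * Complex.I) φ := by
  have h := ((hasDerivAt_id (φ : ℂ)).mul_const Complex.I).cexp.comp_ofReal
  simp only [id_eq, one_mul] at h
  exact h

lemma analyticAt_exp_comp {f : ℝ → ℂ} {x : ℝ} (hf : AnalyticAt ℝ f x) :
    AnalyticAt ℝ (fun y => Complex.exp (f y)) x :=
  (analyticAt_cexp (z := f x)).restrictScalars.comp hf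

lemma analyticAt_circlePt (φ : ℝ) : AnalyticAt ℝ circlePt φ :=
  analyticAt_exp_comp
    ((analyticAt_ofReal_comp (f := fun x => x) analyticAt_id).mul analyticAt_const)

/-- Keeps `1 - λ z` off the branch cut, so the principal logarithm is analytic along the whole
circle. -/
lemma re_one_sub_pos {lam : ℝ} (hlam : lam ∈ Ioo (0 : ℝ) 1)
    (φ : ℝ) : 0 < (1 - (lam : ℂ) * circlePt φ).re := by
  rw [Complex.sub_re, Complex.one_re, Complex.re_ofReal_mul, circlePt_re]
  nlinarith [Real.cos_le_one φ, hlam.1, hlam.2]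

lemma one_sub_ne_zero {lam : ℝ} (hlam : lam ∈ Ioo (0 : ℝ) 1)
    (φ : ℝ) : 1 - (lam : ℂ) * circlePt φ ≠ 0 := by
  intro h
  have := re_one_sub_pos hlam φ
  rw [h] at this
  simp at this

lemma exp_logFactor {lam : ℝ} (hlam : lam ∈ Ioo (0 : ℝ) 1)
    (φ : ℝ) : Complex.exp (logFactor lam φ) = 1 - (lam : ℂ) * circlePt φ :=
  Complex.exp_log (one_sub_ne_zero hlam φ)

lemma sqModulus_pos {lam : ℝ} (hlam : lam ∈ Ioo (0 : ℝ) 1) (φ : ℝ) : 0 < sqModulus lam φ := by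
  unfold sqModulus
  nlinarith [Real.cos_le_one φ, hlam.1, hlam.2]

/-- From `z * conj z = 1`: `z - λ = z (1 - λ conj z)`. This makes the base unimodular and doubles
the argument of `1 - λ z` in the phase. -/
lemma sub_eq_exp {lam : ℝ} (hlam : lam ∈ Ioo (0 : ℝ) 1) (φ : ℝ) :
    circlePt φ - (lam : ℂ) = Complex.exp (φ * Complex.I) * Complex.exp (conj (logFactor lam φ)) := by
  rw [Complex.exp_conj, exp_logFactor hlam, map_sub, map_mul, map_one, Complex.conj_ofReal]
  have := circlePt_mul_conj φ
  change _ = circlePt φ * _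
  linear_combination (lam : ℂ) * this

lemma base_eq_exp {lam : ℝ} (hlam : lam ∈ Ioo (0 : ℝ) 1)
    (a : ℝ) {φ : ℝ} (hφ : φ ∈ Ioc (-Real.pi) Real.pi) :
    base lam a (circlePt φ) = Complex.exp (Complex.I * contPhase lam a φ) := by
  rw [base, circlePt_cpow hφ, sub_eq_exp hlam, ← exp_logFactor hlam, ← Complex.exp_add,
    ← Complex.exp_sub, ← Complex.exp_add]
  congr 1
  have h := Complex.sub_conj (logFactor lam φ)
  rw [contPhase]
  push_cast at h ⊢
  linear_combination h

lemma amplitude_eq {lam : ℝ} (hlam : lam ∈ Ioo (0 : ℝ) 1)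
    (α β : ℝ) {φ : ℝ} (hφ : φ ∈ Ioc (-Real.pi) Real.pi) :
    amplitude lam α β (circlePt φ) = contAmplitude lam α β φ := by
  rw [amplitude, circlePt_cpow hφ, sub_eq_exp hlam,
    Complex.cpow_def_of_ne_zero (one_sub_ne_zero hlam φ), ← Complex.exp_add,
    ← Complex.exp_sub, ← Complex.exp_add, contAmplitude, ← logFactor]
  congr 1
  ring

lemma fourierIntegral_eq {lam : ℝ} (hlam : lam ∈ Ioo (0 : ℝ) 1) (a α β : ℝ) (n : ℕ) :
    fourierIntegral lam a α β n = 1 / Real.pi *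
      (∫ φ in (0 : ℝ)..Real.pi, contAmplitude lam α β φ *
        Complex.exp (Complex.I * ((n : ℝ) : ℂ) * contPhase lam a φ)).re := by
  rw [fourierIntegral]
  congr 2
  refine intervalIntegral.integral_congr fun φ hφ => ?_
  rw [uIcc_of_le Real.pi_pos.le] at hφ
  have hφ' : φ ∈ Ioc (-Real.pi) Real.pi := ⟨by linarith [hφ.1, Real.pi_pos], hφ.2⟩
  rw [base_eq_exp hlam a hφ', amplitude_eq hlam α β hφ', ← Complex.exp_nat_mul]
  congr 2
  push_cast
  ring

/-- The continuous phase agrees with the principal one up to a multiple of `2π`. -/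
lemma exists_phase_eq {lam : ℝ} (hlam : lam ∈ Ioo (0 : ℝ) 1)
    (a : ℝ) {φ : ℝ} (hφ : φ ∈ Ioc (-Real.pi) Real.pi) :
    ∃ m : ℤ, phase lam a φ = contPhase lam a φ + m * (2 * Real.pi) := by
  have h1 : Complex.exp (phase lam a φ * Complex.I) =
      Complex.exp (contPhase lam a φ * Complex.I) := by
    have h2 := Complex.norm_mul_exp_arg_mul_I (base lam a (circlePt φ))
    have h3 : ‖base lam a (circlePt φ)‖ = 1 := by
      rw [base_eq_exp hlam a hφ, mul_comm, Complex.norm_exp_ofReal_mul_I]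
    rw [h3, Complex.ofReal_one, one_mul] at h2
    rw [phase, h2, base_eq_exp hlam a hφ, mul_comm]
  obtain ⟨m, hm⟩ := Complex.exp_eq_exp_iff_exists_int.mp h1
  refine ⟨m, ?_⟩
  have h4 := congrArg Complex.im hm
  simpa using h4

lemma analyticAt_logFactor {lam : ℝ} (hlam : lam ∈ Ioo (0 : ℝ) 1)
    (φ : ℝ) : AnalyticAt ℝ (logFactor lam) φ := by
  have h2 : AnalyticAt ℂ Complex.log (1 - (lam : ℂ) * circlePt φ) :=
    analyticAt_clog (Or.inl (re_one_sub_pos hlam φ))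
  have h3 : AnalyticAt ℝ (fun φ => 1 - (lam : ℂ) * circlePt φ) φ :=
    analyticAt_const.sub (analyticAt_const.mul (analyticAt_circlePt φ))
  exact AnalyticAt.comp (f := fun φ => 1 - (lam : ℂ) * circlePt φ) h2.restrictScalars h3

lemma analyticAt_contPhase {lam : ℝ} (hlam : lam ∈ Ioo (0 : ℝ) 1)
    (a φ : ℝ) : AnalyticAt ℝ (contPhase lam a) φ := by
  have h1 : AnalyticAt ℝ (fun φ => (logFactor lam φ).im) φ :=
    (Complex.imCLM.analyticAt _).comp (analyticAt_logFactor hlam φ)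
  exact (analyticAt_const.mul analyticAt_id).add (analyticAt_const.mul h1)

lemma analyticAt_contAmplitude {lam : ℝ} (hlam : lam ∈ Ioo (0 : ℝ) 1)
    (α β φ : ℝ) : AnalyticAt ℝ (contAmplitude lam α β) φ := by
  have h0 := analyticAt_logFactor hlam φ
  have h1 : AnalyticAt ℝ (fun φ => conj (logFactor lam φ)) φ :=
    (Complex.conjCLE.toContinuousLinearMap.analyticAt _).comp h0
  have h2 : AnalyticAt ℝ (fun x : ℝ => (x : ℂ)) φ :=
    analyticAt_ofReal_comp (f := fun x => x) analyticAt_id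
  exact analyticAt_exp_comp (((analyticAt_const.mul (analyticAt_const.mul h2)).add
    (analyticAt_const.mul h0)).sub h1)

/-- The relation defining `C` is kept free of denominators so that one formula serves the interior
case `C = c` and the degenerate cases `C = 1` and `C = -1`. -/
lemma deriv_contPhase {lam : ℝ} (hlam : lam ∈ Ioo (0 : ℝ) 1)
    {a C : ℝ} (hC : 2 * lam * (a + 1) * C = a + a * lam ^ 2 + 2 * lam ^ 2)
    (φ : ℝ) :
    deriv (contPhase lam a) φ = 2 * lam * (a + 1) * (C - Real.cos φ) / sqModulus lam φ := by
  have h2 : HasDerivAt (logFactor lam)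
      (-((lam : ℂ) * (circlePt φ * Complex.I)) / (1 - (lam : ℂ) * circlePt φ)) φ :=
    (((hasDerivAt_circlePt φ).const_mul (lam : ℂ)).const_sub 1).clog_real (Or.inl (re_one_sub_pos hlam φ))
  have h3 : HasDerivAt (fun φ => (logFactor lam φ).im)
      (-((lam : ℂ) * (circlePt φ * Complex.I)) / (1 - (lam : ℂ) * circlePt φ)).im φ :=
    Complex.imCLM.hasFDerivAt.comp_hasDerivAt φ h2
  have h4 : HasDerivAt (contPhase lam a) _ φ :=
    ((hasDerivAt_id φ).const_mul a).add (h3.const_mul 2)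
  have hD := (sqModulus_pos hlam φ).ne'
  rw [h4.deriv, Complex.div_im, normSq_one_sub]
  simp only [Complex.sub_re, Complex.sub_im, Complex.one_re, Complex.one_im, Complex.neg_re,
    Complex.neg_im, Complex.re_ofReal_mul, Complex.im_ofReal_mul, circlePt_re, circlePt_im,
    Complex.mul_I_re, Complex.mul_I_im]
  field_simp
  rw [sqModulus]
  linear_combination (2 * lam ^ 2) * Real.sin_sq_add_cos_sq φ - hC

lemma exp_re_logFactor {lam : ℝ} (hlam : lam ∈ Ioo (0 : ℝ) 1)
    (φ : ℝ) : Real.exp (logFactor lam φ).re = √(sqModulus lam φ) := by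
  rw [← normSq_one_sub, Complex.normSq_eq_norm_sq, Real.sqrt_sq (norm_nonneg _), ← exp_logFactor hlam,
    Complex.norm_exp]

/-- The polar form of the oscillating integrand. -/
lemma contAmplitude_mul_exp {lam : ℝ} (hlam : lam ∈ Ioo (0 : ℝ) 1) (a α β T φ : ℝ) :
    contAmplitude lam α β φ * Complex.exp (Complex.I * T * contPhase lam a φ) =
      ((√(sqModulus lam φ) ^ (β - 1) : ℝ) : ℂ) *
        Complex.exp (((α * φ + (β + 1) * (logFactor lam φ).im + T * contPhase lam a φ : ℝ) : ℂ) *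
          Complex.I) := by
  rw [← exp_re_logFactor hlam, ← Real.exp_mul, contAmplitude, Complex.ofReal_exp,
    ← Complex.exp_add, ← Complex.exp_add]
  congr 1
  have h1 := Complex.re_add_im (logFactor lam φ)
  have h2 : conj (logFactor lam φ) = (logFactor lam φ).re - (logFactor lam φ).im * Complex.I := by
    apply Complex.ext <;> simp
  rw [h2]
  conv_lhs => rw [← h1]
  push_cast
  simp only [Complex.add_re, Complex.add_im, Complex.ofReal_re, Complex.ofReal_im,
    Complex.mul_I_re, Complex.mul_I_im]
  push_cast
  ring

lemma logFactor_zero_im {lam : ℝ} (hlam : lam ∈ Ioo (0 : ℝ) 1) : (logFactor lam 0).im = 0 := by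
  rw [logFactor, circlePt_zero, mul_one, ← Complex.ofReal_one, ← Complex.ofReal_sub,
    ← Complex.ofReal_log (by linarith [hlam.2]), Complex.ofReal_im]

lemma logFactor_pi_im {lam : ℝ} (hlam : lam ∈ Ioo (0 : ℝ) 1) : (logFactor lam Real.pi).im = 0 := by
  rw [logFactor, circlePt_pi, mul_neg_one, sub_neg_eq_add, ← Complex.ofReal_one,
    ← Complex.ofReal_add, ← Complex.ofReal_log (by linarith [hlam.1]), Complex.ofReal_im]

lemma sqrt_sqModulus_zero {lam : ℝ} (hlam : lam ∈ Ioo (0 : ℝ) 1) :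
    √(sqModulus lam 0) = 1 - lam := by
  rw [sqModulus, Real.cos_zero, show 1 - 2 * lam * 1 + lam ^ 2 = (1 - lam) ^ 2 by ring,
    Real.sqrt_sq (by linarith [hlam.2])]

lemma sqrt_sqModulus_pi {lam : ℝ} (hlam : lam ∈ Ioo (0 : ℝ) 1) :
    √(sqModulus lam Real.pi) = 1 + lam := by
  rw [sqModulus, Real.cos_pi, show 1 - 2 * lam * -1 + lam ^ 2 = (1 + lam) ^ 2 by ring,
    Real.sqrt_sq (by linarith [hlam.1])]

/-! ### Limits, real parts and relative errors -/

lemma tendsto_one_sub_cos_div {D : ℝ → ℝ} (hD : Continuous D) (hD0 : D 0 ≠ 0) (κ : ℝ) :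
    Tendsto (fun x => κ * (1 - Real.cos x) / D x / (x - 0) ^ 2) (𝓝[≠] 0) (𝓝 (κ / (2 * D 0))) := by
  have h : ContinuousAt (fun x => κ * Real.sinc (x / 2) ^ 2 / (2 * D x)) 0 := by
    have := Real.continuous_sinc
    refine ContinuousAt.div (by fun_prop) (by fun_prop) (by simpa using hD0)
  have h2 := h.tendsto.mono_left (nhdsWithin_le_nhds (s := {0}ᶜ))
  simp only [zero_div, Real.sinc_zero, one_pow, mul_one] at h2
  refine h2.congr' ?_
  filter_upwards [self_mem_nhdsWithin] with x hx
  have hx0 : x ≠ 0 := hx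
  have hc : 1 - Real.cos x = 2 * Real.sin (x / 2) ^ 2 := by
    have h3 := Real.cos_two_mul (x / 2)
    rw [mul_div_cancel₀ x two_ne_zero] at h3
    have h4 := Real.sin_sq_add_cos_sq (x / 2)
    linear_combination -h3 - 2 * h4
  rw [hc, Real.sinc_of_ne_zero (by simpa using hx0), sub_zero]
  rcases eq_or_ne (D x) 0 with h0 | h0
  · simp [h0]
  · field_simp

lemma isBigO_re_natCast {F : ℝ → ℂ} {f : ℝ → ℝ} (h : F =O[atTop] f) :
    (fun n : ℕ => (F n).re) =O[atTop] fun n : ℕ => f n := by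
  have h1 : (fun n : ℕ => (F n).re) =O[atTop] fun n : ℕ => F n := by
    refine IsBigO.of_bound 1 (Eventually.of_forall fun n => ?_)
    rw [one_mul, Real.norm_eq_abs]
    exact Complex.abs_re_le_norm _
  exact h1.trans (h.comp_tendsto tendsto_natCast_atTop_atTop)

lemma re_mul_exp_mul_exp (r θ η s : ℝ) :
    ((r : ℂ) * Complex.exp ((θ : ℂ) * Complex.I) * Complex.exp (Complex.I * η) * (s : ℂ)).re =
      r * s * Real.cos (θ + η) := by
  rw [show (r : ℂ) * Complex.exp ((θ : ℂ) * Complex.I) * Complex.exp (Complex.I * η) * (s : ℂ) =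
      ((r * s : ℝ) : ℂ) * Complex.exp (((θ + η : ℝ) : ℂ) * Complex.I) by
    rw [mul_assoc (r : ℂ), ← Complex.exp_add]
    push_cast
    ring_nf]
  rw [Complex.re_ofReal_mul, Complex.exp_ofReal_mul_I_re]

/-- Division by `i` exchanges cosine for sine, which is why endpoint contributions enter through a
sine. -/
lemma re_mul_exp_div (r θ T d : ℝ) :
    ((r : ℂ) * Complex.exp ((θ : ℂ) * Complex.I) / (Complex.I * T * d)).re =
      r * Real.sin θ / (T * d) := by
  rw [show (r : ℂ) * Complex.exp ((θ : ℂ) * Complex.I) / (Complex.I * T * d) =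
      ((r / (T * d) : ℝ) : ℂ) * (Complex.exp ((θ : ℂ) * Complex.I) * -Complex.I) by
    push_cast
    rw [div_eq_mul_inv, mul_assoc Complex.I, mul_inv, Complex.inv_I]
    ring]
  rw [Complex.re_ofReal_mul, mul_neg, Complex.neg_re, Complex.mul_I_re,
    Complex.exp_ofReal_mul_I_im, neg_neg]
  ring

/-- An absolute error `n^{-2/3}` becomes a relative error `n^{-1/3}` once `|M n|` is at least of
order `n^{-1/3}`. The predicate `P` selects the indices where this holds, and `ε` is set to `0`
elsewhere. -/
lemma exists_relative_error {I M : ℕ → ℝ} {P : ℕ → Prop} {K : ℝ} (hK : 0 < K)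
    (h : (fun n => I n - M n) =O[atTop] fun n : ℕ => (n : ℝ) ^ (-(2 / 3) : ℝ))
    (hM : ∀ᶠ n in atTop, P n → K * (n : ℝ) ^ (-(1 / 3) : ℝ) ≤ |M n|) :
    ∃ ε : ℕ → ℝ, ε =O[atTop] (fun n : ℕ => (n : ℝ) ^ (-(1 / 3) : ℝ)) ∧
      ∀ᶠ n in atTop, P n → I n = M n * (1 + ε n) := by
  classical
  refine ⟨fun n => if P n then (I n - M n) / M n else 0, ?_, ?_⟩
  · obtain ⟨C, hC⟩ := h.bound
    refine IsBigO.of_bound (C / K) ?_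
    filter_upwards [hC, hM, eventually_gt_atTop 0] with n h1 h2 hn
    have hn' : (0 : ℝ) < n := by exact_mod_cast hn
    have hpos : 0 < K * (n : ℝ) ^ (-(1 / 3) : ℝ) := by positivity
    have hC0 : 0 ≤ C * ‖(n : ℝ) ^ (-(2 / 3) : ℝ)‖ := (norm_nonneg _).trans h1
    rw [Real.norm_of_nonneg (by positivity : 0 ≤ (n : ℝ) ^ (-(2 / 3) : ℝ))] at h1 hC0
    have hsplit : (n : ℝ) ^ (-(2 / 3) : ℝ) = (n : ℝ) ^ (-(1 / 3) : ℝ) * (n : ℝ) ^ (-(1 / 3) : ℝ) := by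
      rw [← Real.rpow_add hn']
      norm_num
    have hbound : C / K * (n : ℝ) ^ (-(1 / 3) : ℝ) =
        C * (n : ℝ) ^ (-(2 / 3) : ℝ) / (K * (n : ℝ) ^ (-(1 / 3) : ℝ)) := by
      rw [hsplit]
      field_simp
    rw [Real.norm_of_nonneg (by positivity : 0 ≤ (n : ℝ) ^ (-(1 / 3) : ℝ)), hbound]
    split_ifs with hP
    · rw [norm_div]
      exact div_le_div₀ hC0 h1 hpos (h2 hP)
    · rw [norm_zero]
      positivity
  · filter_upwards [hM, eventually_gt_atTop 0] with n h2 hn hP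
    have hn' : (0 : ℝ) < n := by exact_mod_cast hn
    have hpos : 0 < K * (n : ℝ) ^ (-(1 / 3) : ℝ) := by positivity
    have hne : M n ≠ 0 := abs_pos.mp (hpos.trans_le (h2 hP))
    simp only [if_pos hP]
    field_simp
    ring

lemma continuous_sqModulus (lam : ℝ) : Continuous (sqModulus lam) := by
  unfold sqModulus
  fun_prop

lemma Gamma_one_third_add_one : Real.Gamma (1 / 3 + 1) = Real.Gamma (1 / 3) / 3 := by
  rw [Real.Gamma_add_one (by norm_num)]
  ring

/-! ### The stationary point and its coefficient -/

lemma add_one_pos {lam a : ℝ} (hlam : lam ∈ Ioo (0 : ℝ) 1)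
    (ha : -(2 * lam / (1 + lam)) ≤ a) : 0 < a + 1 := by
  have h1 : 2 * lam / (1 + lam) < 1 := by
    rw [div_lt_one (by linarith [hlam.1])]
    linarith [hlam.2]
  linarith

lemma lower_factor_pos {lam a : ℝ} (hlam : lam ∈ Ioo (0 : ℝ) 1)
    (ha : -(2 * lam / (1 + lam)) < a) : 0 < a * (1 + lam) + 2 * lam := by
  have h0 : 0 < 1 + lam := by linarith [hlam.1]
  have h1 : -(2 * lam / (1 + lam)) * (1 + lam) < a * (1 + lam) := by gcongr
  have h2 : -(2 * lam / (1 + lam)) * (1 + lam) = -(2 * lam) := by field_simp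
  linarith

lemma upper_factor_pos {lam a : ℝ} (hlam : lam ∈ Ioo (0 : ℝ) 1)
    (ha : a < 2 * lam / (1 - lam)) : 0 < 2 * lam - a * (1 - lam) := by
  rw [lt_div_iff₀ (by linarith [hlam.2])] at ha
  linarith

lemma two_mul_cosPhiPlus {lam a : ℝ} (hlam : lam ∈ Ioo (0 : ℝ) 1) (ha : 0 < a + 1) :
    2 * lam * (a + 1) * cosPhiPlus lam a = a + a * lam ^ 2 + 2 * lam ^ 2 := by
  have := hlam.1.ne'
  rw [cosPhiPlus]
  field_simp

/-- Over the denominator `2λ(a+1)`, the numerators of `1 + c` and `1 - c` factor as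
`(1+λ)(a(1+λ)+2λ)` and `(1-λ)(2λ-a(1-λ))`, positive exactly inside the admissible interval for `a`.
-/
lemma cosPhiPlus_mem {lam a : ℝ} (hlam : lam ∈ Ioo (0 : ℝ) 1)
    (ha : a ∈ Ioo (-(2 * lam / (1 + lam))) (2 * lam / (1 - lam))) :
    cosPhiPlus lam a ∈ Ioo (-1 : ℝ) 1 := by
  have h0 := add_one_pos hlam ha.1.le
  have h1 := lower_factor_pos hlam ha.1
  have h2 := upper_factor_pos hlam ha.2
  have h3 : 0 < 2 * lam * (a + 1) := by
    have := hlam.1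
    positivity
  rw [cosPhiPlus]
  constructor
  · rw [lt_div_iff₀ h3]
    nlinarith [mul_pos (by linarith [hlam.1] : 0 < 1 + lam) h1]
  · rw [div_lt_one h3]
    nlinarith [mul_pos (by linarith [hlam.2] : 0 < 1 - lam) h2]

lemma IsPhiPlus.cos_eq {lam a φ : ℝ} (h : IsPhiPlus lam a φ) :
    Real.cos φ = cosPhiPlus lam a := by
  have h1 := congrArg Complex.re h.2
  rw [circlePt_re] at h1
  simpa using h1

lemma isPhiPlus_arccos {lam a : ℝ} (hC : cosPhiPlus lam a ∈ Ioo (-1 : ℝ) 1) :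
    IsPhiPlus lam a (Real.arccos (cosPhiPlus lam a)) := by
  refine ⟨⟨Real.arccos_nonneg _, Real.arccos_le_pi _⟩, ?_⟩
  apply Complex.ext
  · rw [circlePt_re, Real.cos_arccos hC.1.le hC.2.le]
    simp
  · rw [circlePt_im, Real.sin_arccos]
    simp

lemma IsPhiPlus.eq_arccos {lam a φ : ℝ} (h : IsPhiPlus lam a φ) :
    φ = Real.arccos (cosPhiPlus lam a) := by
  rw [← h.cos_eq, Real.arccos_cos h.1.1 h.1.2]

lemma IsPhiPlus.sqModulus_eq {lam a : ℝ} (hlam : lam ∈ Ioo (0 : ℝ) 1)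
    {φ : ℝ} (ha : 0 < a + 1) (h : IsPhiPlus lam a φ) :
    sqModulus lam φ = (1 - lam ^ 2) / (a + 1) := by
  have h1 := two_mul_cosPhiPlus hlam ha
  rw [eq_div_iff ha.ne', sqModulus, h.cos_eq]
  linear_combination -h1

lemma IsPhiPlus.isPsi {lam a : ℝ} (hlam : lam ∈ Ioo (0 : ℝ) 1)
    {φ : ℝ} (ha : 0 < a + 1) (h : IsPhiPlus lam a φ) :
    IsPsi lam a φ (logFactor lam φ).im := by
  refine ⟨⟨Complex.neg_pi_lt_log_im _, Complex.log_im_le_pi _⟩, ?_⟩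
  rw [← h.sqModulus_eq hlam ha, ← exp_re_logFactor hlam, circlePt, Complex.ofReal_exp,
    ← Complex.exp_add, Complex.re_add_im, exp_logFactor hlam]

lemma IsPsi.eq {lam a : ℝ} (hlam : lam ∈ Ioo (0 : ℝ) 1)
    {φ ψ : ℝ} (ha : 0 < a + 1) (h : IsPsi lam a φ ψ) :
    ψ = (logFactor lam φ).im := by
  have h0 : 0 < (1 - lam ^ 2) / (a + 1) := by
    have : 0 < 1 - lam ^ 2 := by nlinarith [hlam.1, hlam.2]
    positivity
  rw [logFactor, Complex.log_im, ← h.2, circlePt, Complex.exp_mul_I,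
    Complex.arg_mul_cos_add_sin_mul_I (Real.sqrt_pos.mpr h0) h.1]

/-- The leading coefficient of the stationary point. -/
lemma stationary_coefficient {lam a : ℝ} (hlam : lam ∈ Ioo (0 : ℝ) 1)
    (ha : a ∈ Ioo (-(2 * lam / (1 + lam))) (2 * lam / (1 - lam)))
    (β : ℝ) {φ n : ℝ} (h : IsPhiPlus lam a φ) (hn : 0 < n) :
    1 / Real.pi * (√((1 - lam ^ 2) / (a + 1)) ^ (β - 1) *
        √(2 * Real.pi / (n * (2 * lam * (a + 1) * Real.sin φ / ((1 - lam ^ 2) / (a + 1)))))) =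
      √(2 / (n * Real.pi)) * ((1 - lam ^ 2) ^ (β / 2) / (a + 1) ^ (β / 2)) /
        ((1 - lam ^ 2) * ((a + 2) * lam + a) * ((a + 2) * lam - a)) ^ (1 / 4 : ℝ) := by
  have h0 := add_one_pos hlam ha.1.le
  have h1 := lower_factor_pos hlam ha.1
  have h2 := upper_factor_pos hlam ha.2
  have hA : 0 < 1 - lam ^ 2 := by nlinarith [hlam.1, hlam.2]
  have hX : 0 < (1 - lam ^ 2) * ((a + 2) * lam + a) * ((a + 2) * lam - a) :=
    mul_pos (mul_pos hA (by linarith)) (by linarith)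
  set X := (1 - lam ^ 2) * ((a + 2) * lam + a) * ((a + 2) * lam - a) with hXdef
  have hC := two_mul_cosPhiPlus hlam h0
  have hsin : 0 ≤ Real.sin φ := Real.sin_nonneg_of_mem_Icc h.1
  -- `X` is the difference of squares `(2λ(a+1))² - (a+aλ²+2λ²)²`, that is `(2λ(a+1))² (1 - c²)`.
  -- Hence the fourth root in the final formula.
  have hS : 2 * lam * (a + 1) * Real.sin φ = √X := by
    rw [eq_comm, Real.sqrt_eq_iff_mul_self_eq hX.le
      (mul_nonneg (by have := hlam.1; positivity) hsin)]
    have h3 := Real.sin_sq_add_cos_sq φ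
    rw [h.cos_eq] at h3
    rw [hXdef]
    linear_combination (2 * lam * (a + 1) * cosPhiPlus lam a + (a + a * lam ^ 2 + 2 * lam ^ 2)) * hC
      - (2 * lam * (a + 1)) ^ 2 * h3
  rw [hS]
  have hSpos : 0 < √X := Real.sqrt_pos.mpr hX
  set r := (1 - lam ^ 2) / (a + 1) with hr
  have hrpos : 0 < r := by positivity
  have e1 : X ^ (1 / 4 : ℝ) = √(√X) := by
    rw [Real.sqrt_eq_rpow, Real.sqrt_eq_rpow, ← Real.rpow_mul hX.le]
    norm_num
  have e2 : (1 - lam ^ 2) ^ (β / 2) / (a + 1) ^ (β / 2) = √r ^ β := by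
    rw [← Real.div_rpow hA.le h0.le, Real.sqrt_eq_rpow, ← Real.rpow_mul hrpos.le]
    congr 1
    ring
  have e3 : √r ^ (β - 1) = √r ^ β / √r := by
    rw [Real.rpow_sub (Real.sqrt_pos.mpr hrpos), Real.rpow_one]
  have e4 : 1 / Real.pi * √(2 * Real.pi / (n * (√X / r))) = √(2 / (n * Real.pi)) * √r / √(√X) := by
    have hpi := Real.pi_pos
    rw [← Real.sqrt_mul (by positivity), ← Real.sqrt_div (by positivity), eq_comm,
      Real.sqrt_eq_iff_mul_self_eq (by positivity) (by positivity)]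
    have h5 := Real.mul_self_sqrt (show 0 ≤ 2 * Real.pi / (n * (√X / r)) by positivity)
    symm
    calc _ = 1 / Real.pi ^ 2 * (√(2 * Real.pi / (n * (√X / r))) *
          √(2 * Real.pi / (n * (√X / r)))) := by ring
      _ = _ := by
        rw [h5]
        field_simp
  have hsr : √r ≠ 0 := (Real.sqrt_pos.mpr hrpos).ne'
  rw [e1, e2, e3]
  calc _ = √r ^ β / √r * (1 / Real.pi * √(2 * Real.pi / (n * (√X / r)))) := by ring
    _ = _ := by
      rw [e4]
      field_simp

/-! ### The three asymptotic regimes -/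

theorem isBigO_fourierIntegral_sub_interior {lam a : ℝ} (hlam : lam ∈ Ioo (0 : ℝ) 1)
    (ha : a ∈ Ioo (-(2 * lam / (1 + lam))) (2 * lam / (1 - lam))) (α β : ℝ) {φ ψ : ℝ}
    (hφ : IsPhiPlus lam a φ) (hψ : IsPsi lam a φ ψ) :
    (fun n : ℕ => fourierIntegral lam a α β n -
        (stationaryTerm lam a α β φ ψ n + endpointTerm lam a α β n))
      =O[atTop] fun n : ℕ => (n : ℝ) ^ (-(3 / 2) : ℝ) := by
  have h0 := add_one_pos hlam ha.1.le
  have hC := cosPhiPlus_mem hlam ha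
  have hcos := hφ.cos_eq
  have hD := hφ.sqModulus_eq hlam h0
  have hDpos := sqModulus_pos hlam
  have hl := hlam.1
  have hφ0 : 0 < φ := by
    refine lt_of_le_of_ne hφ.1.1 fun h => ?_
    rw [← h, Real.cos_zero] at hcos
    linarith [hC.2]
  have hφpi : φ < Real.pi := by
    refine lt_of_le_of_ne hφ.1.2 fun h => ?_
    rw [h, Real.cos_pi] at hcos
    linarith [hC.1]
  have hsin : 0 < Real.sin φ := Real.sin_pos_of_pos_of_lt_pi hφ0 hφpi
  have hderiv : ∀ x, deriv (contPhase lam a) x =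
      2 * lam * (a + 1) * (Real.cos φ - Real.cos x) / sqModulus lam x := by
    intro x
    rw [hcos]
    exact deriv_contPhase hlam (two_mul_cosPhiPlus hlam h0) x
  set ℓ : ℝ := 2 * lam * (a + 1) * Real.sin φ / sqModulus lam φ with hℓ
  have hlim : Tendsto (fun x => deriv (contPhase lam a) x / (x - φ)) (𝓝[≠] φ) (𝓝 ℓ) := by
    have h1 := hasDerivAt_iff_tendsto_slope.mp (Real.hasDerivAt_cos φ)
    have h2 : ContinuousAt (fun x => -(2 * lam * (a + 1)) / sqModulus lam x) φ :=
      ContinuousAt.div continuousAt_const (continuous_sqModulus lam).continuousAt (hDpos φ).ne'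
    have h3 := (h2.tendsto.mono_left (nhdsWithin_le_nhds (s := {φ}ᶜ))).mul h1
    have h4 : -(2 * lam * (a + 1)) / sqModulus lam φ * -Real.sin φ = ℓ := by
      rw [hℓ]
      ring
    rw [h4] at h3
    refine h3.congr fun x => ?_
    rw [hderiv, slope_def_field]
    ring
  have hsign : ∀ x ∈ Icc 0 Real.pi, x ≠ φ → 0 < deriv (contPhase lam a) x / (x - φ) := by
    intro x hx hne
    have hk : 0 < 2 * lam * (a + 1) := by positivity
    rw [hderiv]
    rcases lt_or_gt_of_ne hne with h | h
    · have h1 := Real.strictAntiOn_cos hx hφ.1 h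
      refine div_pos_of_neg_of_neg (div_neg_of_neg_of_pos ?_ (hDpos x)) (by linarith)
      exact mul_neg_of_pos_of_neg hk (by linarith)
    · have h1 := Real.strictAntiOn_cos hφ.1 hx h
      exact div_pos (div_pos (mul_pos hk (by linarith)) (hDpos x)) (by linarith)
  have hmain := isBigO_stationary_phase (p := 0) (q := Real.pi) hφ0 hφpi
    (fun x _ => analyticAt_contAmplitude hlam α β x) (fun x _ => analyticAt_contPhase hlam a x)
    (by have := hDpos φ; positivity) hlim hsign
  refine ((isBigO_re_natCast hmain).const_mul_left (1 / Real.pi)).congr' ?_ EventuallyEq.rfl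
  filter_upwards [eventually_gt_atTop 0] with n hn
  have hn' : (0 : ℝ) < n := by exact_mod_cast hn
  simp only [contAmplitude_mul_exp hlam]
  rw [Complex.sub_re, Complex.add_re, Complex.sub_re, mul_sub]
  simp only [← contAmplitude_mul_exp hlam]
  rw [← fourierIntegral_eq hlam]
  simp only [contAmplitude_mul_exp hlam]
  have hquarter : Complex.exp (Complex.I * (Real.pi / 4)) =
      Complex.exp (Complex.I * ((Real.pi / 4 : ℝ) : ℂ)) := by push_cast; rfl
  rw [hquarter, re_mul_exp_mul_exp, re_mul_exp_div, re_mul_exp_div]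
  congr 1
  have hpiH : contPhase lam a Real.pi = a * Real.pi := by
    rw [contPhase, logFactor_pi_im hlam]
    ring
  have h0H : contPhase lam a 0 = 0 := by
    rw [contPhase, logFactor_zero_im hlam]
    ring
  have hendpi : √(sqModulus lam Real.pi) ^ (β - 1) * Real.sin (α * Real.pi +
      (β + 1) * (logFactor lam Real.pi).im + n * contPhase lam a Real.pi) /
        (n * deriv (contPhase lam a) Real.pi) = Real.pi * endpointTerm lam a α β n := by
    have h1 : 0 < 1 + lam := by linarith
    have hE := lower_factor_pos hlam ha.1
    have hd : deriv (contPhase lam a) Real.pi = (a * (1 + lam) + 2 * lam) / (1 + lam) := by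
      have h2 := two_mul_cosPhiPlus hlam h0
      rw [deriv_contPhase hlam h2, sqModulus, Real.cos_pi, div_eq_div_iff (by nlinarith) h1.ne']
      linear_combination (1 + lam) * h2
    rw [hd, hpiH, logFactor_pi_im hlam, sqrt_sqModulus_pi hlam, Real.rpow_sub h1, Real.rpow_one,
      endpointTerm]
    have hpi := Real.pi_pos.ne'
    rw [show α * Real.pi + (β + 1) * 0 + n * (a * Real.pi) = (a * n + α) * Real.pi by ring]
    field_simp
  -- Phase and argument of the amplitude both vanish at `φ = 0`, so the left endpoint drops out of
  -- the real part.
  have hend0 : Real.sin (α * 0 + (β + 1) * (logFactor lam 0).im + n * contPhase lam a 0) = 0 := by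
    rw [h0H, logFactor_zero_im hlam]
    simp
  rw [hendpi, hend0, mul_zero, zero_div, sub_zero, mul_add]
  have hpi := Real.pi_pos.ne'
  congr 1
  -- Since `H = a φ + 2ψ` at `φ₊`, `n H + α φ + (β+1) ψ` equals `(n+1) H + (α-a) φ + (β-1) ψ`.
  -- Replacing `H` by the principal phase shifts this by `(n+1) m` full turns.
  · obtain ⟨m, hm⟩ := exists_phase_eq hlam a (φ := φ) ⟨by linarith [Real.pi_pos], hφpi.le⟩
    have harg : Real.cos (α * φ + (β + 1) * (logFactor lam φ).im + n * contPhase lam a φ +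
        Real.pi / 4) = Real.cos ((n + 1) * phase lam a φ + (α - a) * φ + (β - 1) * ψ +
          Real.pi / 4) := by
      rw [hm, hψ.eq hlam h0,
        ← Real.cos_add_int_mul_two_pi (α * φ + _ + _ + _) ((n + 1) * m)]
      congr 1
      push_cast
      rw [contPhase]
      ring
    have hcoef := stationary_coefficient hlam ha β hφ hn'
    rw [harg, stationaryTerm, hℓ, hD, ← mul_assoc, hcoef]
    ring
  · field_simp

theorem isBigO_fourierIntegral_sub_upper {lam a : ℝ} (hlam : lam ∈ Ioo (0 : ℝ) 1)
    (ha : a = 2 * lam / (1 - lam)) (α β : ℝ) :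
    (fun n : ℕ => fourierIntegral lam a α β n - upperTerm lam β n)
      =O[atTop] fun n : ℕ => (n : ℝ) ^ (-(2 / 3) : ℝ) := by
  have hl := hlam.1
  have hl1 : 0 < 1 - lam := by linarith [hlam.2]
  have ha1 : a + 1 = (1 + lam) / (1 - lam) := by
    rw [ha]
    field_simp
    ring
  have hC : 2 * lam * (a + 1) * 1 = a + a * lam ^ 2 + 2 * lam ^ 2 := by
    rw [ha]
    field_simp
    ring
  have hD0 : sqModulus lam 0 = (1 - lam) ^ 2 := by
    rw [sqModulus, Real.cos_zero]
    ring
  have hDpos := sqModulus_pos hlam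
  set ℓ : ℝ := lam * (1 + lam) / (1 - lam) ^ 3 with hℓ
  have hℓeq : 2 * lam * (a + 1) / (2 * sqModulus lam 0) = ℓ := by
    rw [hℓ, ha1, hD0]
    field_simp
  have hlim : Tendsto (fun x => deriv (contPhase lam a) x / (x - 0) ^ 2) (𝓝[≠] 0) (𝓝 ℓ) := by
    simp only [deriv_contPhase hlam hC]
    rw [← hℓeq]
    exact tendsto_one_sub_cos_div (continuous_sqModulus lam) (hDpos 0).ne' _
  have hsign : ∀ x ∈ Icc 0 Real.pi, x ≠ 0 → 0 < deriv (contPhase lam a) x / (x - 0) ^ 2 := by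
    intro x hx hne
    have h1 := Real.strictAntiOn_cos (left_mem_Icc.mpr Real.pi_pos.le) hx
      (lt_of_le_of_ne hx.1 hne.symm)
    rw [Real.cos_zero] at h1
    rw [deriv_contPhase hlam hC, sub_zero]
    have h2 : 0 < a + 1 := by rw [ha1]; positivity
    have h3 : 0 < 1 - Real.cos x := by linarith
    have := hDpos x
    positivity
  have hmain := isBigO_stationary_phase_endpoint (p := 0) (q := Real.pi) Real.pi_pos
    (fun x _ => analyticAt_contAmplitude hlam α β x) (fun x _ => analyticAt_contPhase hlam a x)
    (by positivity) hlim hsign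
  refine ((isBigO_re_natCast hmain).const_mul_left (1 / Real.pi)).congr' ?_ EventuallyEq.rfl
  filter_upwards [eventually_gt_atTop 0] with n hn
  have hn' : (0 : ℝ) < n := by exact_mod_cast hn
  rw [Complex.sub_re, mul_sub, ← fourierIntegral_eq hlam, contAmplitude_mul_exp hlam]
  have hsixth : Complex.exp (Complex.I * (Real.pi / 6)) =
      Complex.exp (Complex.I * ((Real.pi / 6 : ℝ) : ℂ)) := by push_cast; rfl
  rw [hsixth, re_mul_exp_mul_exp]
  congr 1
  have h0H : contPhase lam a 0 = 0 := by
    rw [contPhase, logFactor_zero_im hlam]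
    ring
  rw [h0H, logFactor_zero_im hlam, sqrt_sqModulus_zero hlam]
  simp only [mul_zero, add_zero, zero_add]
  rw [Real.cos_pi_div_six, Real.rpow_sub hl1, Real.rpow_one, Gamma_one_third_add_one, upperTerm]
  -- The reflection formula at `1/3` absorbs `cos (π/6) = √3/2` and moves the Gamma factor to the
  -- denominator as `Γ(2/3)`.
  have hrefl : Real.Gamma (1 / 3) * Real.Gamma (2 / 3) * √3 = 2 * Real.pi := by
    have h1 := Real.Gamma_mul_Gamma_one_sub (1 / 3)
    rw [show (1 : ℝ) - 1 / 3 = 2 / 3 by norm_num, show Real.pi * (1 / 3) = Real.pi / 3 by ring,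
      Real.sin_pi_div_three] at h1
    rw [h1]
    field_simp
  have hcube : (3 / (n * ℓ)) ^ (1 / 3 : ℝ) = 3 ^ (1 / 3 : ℝ) * (1 - lam) /
      ((n : ℝ) ^ (1 / 3 : ℝ) * lam ^ (1 / 3 : ℝ) * (1 + lam) ^ (1 / 3 : ℝ)) := by
    have h1 : ((1 - lam) ^ 3) ^ (1 / 3 : ℝ) = 1 - lam := by
      rw [← Real.rpow_natCast, ← Real.rpow_mul hl1.le]
      norm_num
    rw [show 3 / (n * ℓ) = 3 * (1 - lam) ^ 3 / (n * lam * (1 + lam)) by rw [hℓ]; field_simp,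
      Real.div_rpow (by positivity) (by positivity), Real.mul_rpow (by positivity) (by positivity),
      Real.mul_rpow (by positivity) (by positivity), Real.mul_rpow (by positivity) (by positivity),
      h1]
  have hthree : (3 : ℝ) ^ (1 / 3 : ℝ) * 3 ^ (2 / 3 : ℝ) = 3 := by
    rw [← Real.rpow_add (by norm_num)]
    norm_num
  have hG : 0 < Real.Gamma (2 / 3) := Real.Gamma_pos_of_pos (by norm_num)
  have h32 : (0 : ℝ) < 3 ^ (2 / 3 : ℝ) := by positivity
  have hpi := Real.pi_pos
  rw [hcube]
  field_simp
  linear_combination (2 * Real.pi) * hthree +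
    3 ^ (1 / 3 : ℝ) * 3 ^ (2 / 3 : ℝ) * hrefl

/-- The degenerate point is the right endpoint and `H` decreases towards it. The substitution `t = π
- φ` moves it to the left endpoint and makes the phase increasing, as
`isBigO_stationary_phase_endpoint` requires. -/
theorem isBigO_fourierIntegral_sub_lower {lam a : ℝ} (hlam : lam ∈ Ioo (0 : ℝ) 1)
    (ha : a = -(2 * lam / (1 + lam))) (α β : ℝ) :
    (fun n : ℕ => fourierIntegral lam a α β n - lowerTerm lam a α β n)
      =O[atTop] fun n : ℕ => (n : ℝ) ^ (-(2 / 3) : ℝ) := by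
  have hl := hlam.1
  have hl1 : 0 < 1 - lam := by linarith [hlam.2]
  have hl2 : 0 < 1 + lam := by linarith
  have ha1 : a + 1 = (1 - lam) / (1 + lam) := by
    rw [ha]
    field_simp
    ring
  have hC : 2 * lam * (a + 1) * -1 = a + a * lam ^ 2 + 2 * lam ^ 2 := by
    rw [ha]
    field_simp
    ring
  have hDpi : sqModulus lam Real.pi = (1 + lam) ^ 2 := by
    rw [sqModulus, Real.cos_pi]
    ring
  have hDpos := sqModulus_pos hlam
  set ℓ : ℝ := lam * (1 - lam) / (1 + lam) ^ 3 with hℓ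
  have hℓeq : 2 * lam * (a + 1) / (2 * sqModulus lam (Real.pi - 0)) = ℓ := by
    rw [hℓ, ha1, sub_zero, hDpi]
    field_simp
  have hderiv : ∀ x, deriv (fun t => contPhase lam a (Real.pi - t)) x =
      2 * lam * (a + 1) * (1 - Real.cos x) / sqModulus lam (Real.pi - x) := by
    intro x
    rw [deriv_comp_const_sub, deriv_contPhase hlam hC, Real.cos_pi_sub]
    ring
  have hlim : Tendsto (fun x => deriv (fun t => contPhase lam a (Real.pi - t)) x / (x - 0) ^ 2)
      (𝓝[≠] 0) (𝓝 ℓ) := by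
    simp only [hderiv]
    rw [← hℓeq]
    exact tendsto_one_sub_cos_div (D := fun t => sqModulus lam (Real.pi - t))
      ((continuous_sqModulus lam).comp (by fun_prop)) (hDpos _).ne' _
  have hsign : ∀ x ∈ Icc 0 Real.pi, x ≠ 0 →
      0 < deriv (fun t => contPhase lam a (Real.pi - t)) x / (x - 0) ^ 2 := by
    intro x hx hne
    have h1 := Real.strictAntiOn_cos (left_mem_Icc.mpr Real.pi_pos.le) hx
      (lt_of_le_of_ne hx.1 hne.symm)
    rw [Real.cos_zero] at h1
    rw [hderiv, sub_zero]
    have h2 : 0 < a + 1 := by rw [ha1]; positivity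
    have h3 : 0 < 1 - Real.cos x := by linarith
    have := hDpos (Real.pi - x)
    positivity
  have hsub : ∀ x, AnalyticAt ℝ (fun t : ℝ => Real.pi - t) x := fun x => by fun_prop
  have hmain := isBigO_stationary_phase_endpoint (p := 0) (q := Real.pi) Real.pi_pos
    (g := fun t => contAmplitude lam α β (Real.pi - t))
    (H := fun t => contPhase lam a (Real.pi - t))
    (fun x _ => (analyticAt_contAmplitude hlam α β (Real.pi - x)).comp (hsub x))
    (fun x _ => (analyticAt_contPhase hlam a (Real.pi - x)).comp (hsub x))
    (by positivity) hlim hsign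
  refine ((isBigO_re_natCast hmain).const_mul_left (1 / Real.pi)).congr' ?_ EventuallyEq.rfl
  filter_upwards [eventually_gt_atTop 0] with n hn
  have hn' : (0 : ℝ) < n := by exact_mod_cast hn
  have hreflect := intervalIntegral.integral_comp_sub_left (a := 0) (b := Real.pi)
    (fun φ => contAmplitude lam α β φ *
      Complex.exp (Complex.I * ((n : ℝ) : ℂ) * contPhase lam a φ)) Real.pi
  rw [sub_self, sub_zero] at hreflect
  rw [Complex.sub_re, mul_sub, hreflect, ← fourierIntegral_eq hlam, contAmplitude_mul_exp hlam]
  have hsixth : Complex.exp (Complex.I * (Real.pi / 6)) =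
      Complex.exp (Complex.I * ((Real.pi / 6 : ℝ) : ℂ)) := by push_cast; rfl
  rw [hsixth, re_mul_exp_mul_exp, sub_zero]
  congr 1
  have hpiH : contPhase lam a Real.pi = a * Real.pi := by
    rw [contPhase, logFactor_pi_im hlam]
    ring
  rw [hpiH, logFactor_pi_im hlam, sqrt_sqModulus_pi hlam, Real.rpow_sub hl2, Real.rpow_one,
    Gamma_one_third_add_one, lowerTerm,
    show α * Real.pi + (β + 1) * 0 + n * (a * Real.pi) + Real.pi / 6 =
      (a * n + α + 1 / 6) * Real.pi by ring]
  have hcube : (3 / (n * ℓ)) ^ (1 / 3 : ℝ) = 3 ^ (1 / 3 : ℝ) * (1 + lam) *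
      (1 / (n * lam * (1 - lam))) ^ (1 / 3 : ℝ) := by
    have h1 : ((1 + lam) ^ 3) ^ (1 / 3 : ℝ) = 1 + lam := by
      rw [← Real.rpow_natCast, ← Real.rpow_mul hl2.le]
      norm_num
    rw [show 3 / (n * ℓ) = 3 * (1 + lam) ^ 3 * (1 / (n * lam * (1 - lam))) by rw [hℓ]; field_simp,
      Real.mul_rpow (by positivity) (by positivity), Real.mul_rpow (by positivity) (by positivity),
      h1]
  have hthree : (3 : ℝ) ^ (1 / 3 : ℝ) * 3 ^ (2 / 3 : ℝ) = 3 := by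
    rw [← Real.rpow_add (by norm_num)]
    norm_num
  have h32 : (0 : ℝ) < 3 ^ (2 / 3 : ℝ) := by positivity
  have hpi := Real.pi_pos
  rw [hcube]
  generalize Real.cos ((a * n + α + 1 / 6) * Real.pi) = w
  field_simp
  linear_combination w * hthree

/-! ### Size of the leading terms and conclusion -/

lemma upperTerm_eq {lam : ℝ} (β : ℝ) {n : ℝ} (hn : 0 ≤ n) :
    (1 - lam) ^ β / (3 ^ (2 / 3 : ℝ) * Real.Gamma (2 / 3) * n ^ (1 / 3 : ℝ) * lam ^ (1 / 3 : ℝ) *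
      (1 + lam) ^ (1 / 3 : ℝ)) =
    (1 - lam) ^ β / (3 ^ (2 / 3 : ℝ) * Real.Gamma (2 / 3) * lam ^ (1 / 3 : ℝ) *
      (1 + lam) ^ (1 / 3 : ℝ)) * n ^ (-(1 / 3) : ℝ) := by
  rw [Real.rpow_neg hn]
  simp only [div_eq_mul_inv, mul_inv]
  ring

lemma abs_lowerTerm_eq {lam : ℝ} (hlam : lam ∈ Ioo (0 : ℝ) 1) (a α β : ℝ) (n : ℕ) :
    |lowerTerm lam a α β n| = |Real.cos ((a * n + α + 1 / 6) * Real.pi)| *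
      (1 / Real.pi * (Real.Gamma (1 / 3) * (1 + lam) ^ β / 3 ^ (2 / 3 : ℝ)) *
        (1 / (lam * (1 - lam))) ^ (1 / 3 : ℝ)) * (n : ℝ) ^ (-(1 / 3) : ℝ) := by
  have hl := hlam.1
  have hl1 : 0 < 1 - lam := by linarith [hlam.2]
  have hG : 0 < Real.Gamma (1 / 3) := Real.Gamma_pos_of_pos (by norm_num)
  have hpi := Real.pi_pos
  have h1 : (1 / (n * lam * (1 - lam))) ^ (1 / 3 : ℝ) =
      (1 / (lam * (1 - lam))) ^ (1 / 3 : ℝ) * (n : ℝ) ^ (-(1 / 3) : ℝ) := by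
    rw [Real.rpow_neg (Nat.cast_nonneg n), ← Real.inv_rpow (Nat.cast_nonneg n),
      ← Real.mul_rpow (by positivity) (by positivity)]
    congr 1
    rw [mul_assoc, one_div, one_div, mul_inv, mul_comm]
  rw [lowerTerm, h1, abs_mul, abs_mul, abs_mul, abs_of_pos (by positivity : 0 < 1 / Real.pi),
    abs_of_pos (by positivity : 0 < Real.Gamma (1 / 3) * (1 + lam) ^ β / 3 ^ (2 / 3 : ℝ)),
    abs_of_nonneg (by positivity : 0 ≤ (1 / (lam * (1 - lam))) ^ (1 / 3 : ℝ) *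
      (n : ℝ) ^ (-(1 / 3) : ℝ))]
  ring

end UnitCircleIntegral

theorem proposition3p1 (lam a α β : ℝ) (hlam : lam ∈ Set.Ioo (0 : ℝ) 1)
    (ha : a ∈ Set.Icc (-(2 * lam / (1 + lam))) (2 * lam / (1 - lam))) :
    (a ∈ Set.Ioo (-(2 * lam / (1 + lam))) (2 * lam / (1 - lam)) →
      (∃! φ : ℝ, UnitCircleIntegral.IsPhiPlus lam a φ) ∧
      ∀ φ : ℝ, UnitCircleIntegral.IsPhiPlus lam a φ →
        (∃! ψ : ℝ, UnitCircleIntegral.IsPsi lam a φ ψ) ∧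
        ∀ ψ : ℝ, UnitCircleIntegral.IsPsi lam a φ ψ →
          (fun n : ℕ => UnitCircleIntegral.fourierIntegral lam a α β n -
            (UnitCircleIntegral.stationaryTerm lam a α β φ ψ n +
              UnitCircleIntegral.endpointTerm lam a α β n))
            =O[atTop] (fun n : ℕ => (n : ℝ) ^ (-(3 / 2) : ℝ))) ∧
    (a = 2 * lam / (1 - lam) →
      ∃ ε : ℕ → ℝ, ε =O[atTop] (fun n : ℕ => (n : ℝ) ^ (-(1 / 3) : ℝ)) ∧
        ∀ᶠ n : ℕ in atTop, UnitCircleIntegral.fourierIntegral lam a α β n =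
          UnitCircleIntegral.upperTerm lam β n * (1 + ε n)) ∧
    (a = -(2 * lam / (1 + lam)) →
      (fun n : ℕ => UnitCircleIntegral.fourierIntegral lam a α β n -
          UnitCircleIntegral.lowerTerm lam a α β n)
        =O[atTop] (fun n : ℕ => (n : ℝ) ^ (-(2 / 3) : ℝ)) ∧
      ∀ δ : ℝ, 0 < δ →
        ∃ ε : ℕ → ℝ, ε =O[atTop] (fun n : ℕ => (n : ℝ) ^ (-(1 / 3) : ℝ)) ∧
          ∀ᶠ n : ℕ in atTop, δ ≤ |Real.cos ((a * n + α + 1 / 6) * Real.pi)| →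
            UnitCircleIntegral.fourierIntegral lam a α β n =
              UnitCircleIntegral.lowerTerm lam a α β n * (1 + ε n)) := by
  refine ⟨fun ha' => ?_, fun ha' => ?_, fun ha' => ?_⟩
  · have ha1 := UnitCircleIntegral.add_one_pos hlam ha.1
    refine ⟨⟨_, UnitCircleIntegral.isPhiPlus_arccos
      (UnitCircleIntegral.cosPhiPlus_mem hlam ha'), fun φ hφ => hφ.eq_arccos⟩, fun φ hφ => ?_⟩
    exact ⟨⟨_, hφ.isPsi hlam ha1, fun ψ hψ => hψ.eq hlam ha1⟩, fun ψ hψ =>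
      UnitCircleIntegral.isBigO_fourierIntegral_sub_interior hlam ha' α β hφ hψ⟩
  · have hl := hlam.1
    have hl1 : 0 < 1 - lam := by linarith [hlam.2]
    have hG : 0 < Real.Gamma (2 / 3) := Real.Gamma_pos_of_pos (by norm_num)
    -- The upper leading term is a fixed positive multiple of `n^{-1/3}`, so no index has to be
    -- excluded.
    obtain ⟨ε, hε, h⟩ := UnitCircleIntegral.exists_relative_error (P := fun _ => True)
      (K := (1 - lam) ^ β / (3 ^ (2 / 3 : ℝ) * Real.Gamma (2 / 3) * lam ^ (1 / 3 : ℝ) *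
        (1 + lam) ^ (1 / 3 : ℝ))) (by positivity)
      (UnitCircleIntegral.isBigO_fourierIntegral_sub_upper hlam ha' α β)
      (Eventually.of_forall fun n _ => by
        rw [UnitCircleIntegral.upperTerm, UnitCircleIntegral.upperTerm_eq β (Nat.cast_nonneg n)]
        exact le_abs_self _)
    exact ⟨ε, hε, h.mono fun n hn => hn trivial⟩
  · have hO := UnitCircleIntegral.isBigO_fourierIntegral_sub_lower hlam ha' α β
    refine ⟨hO, fun δ hδ => ?_⟩
    have hl := hlam.1
    have hl1 : 0 < 1 - lam := by linarith [hlam.2]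
    have hG : 0 < Real.Gamma (1 / 3) := Real.Gamma_pos_of_pos (by norm_num)
    have hpi := Real.pi_pos
    refine UnitCircleIntegral.exists_relative_error
      (K := δ * (1 / Real.pi * (Real.Gamma (1 / 3) * (1 + lam) ^ β / 3 ^ (2 / 3 : ℝ)) *
        (1 / (lam * (1 - lam))) ^ (1 / 3 : ℝ))) (by positivity) hO
      (Eventually.of_forall fun n hn => ?_)
    rw [UnitCircleIntegral.abs_lowerTerm_eq hlam]
    gcongr
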